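/- Let $\mathbb K$ be a field of characteristic $0$. For a $\mathbb Z$-graded $\mathbb K$-vector space $V$ let $(V[1])^i=V^{i+1}$, let $\overline S(V[1])=\bigoplus_{n\ge 1}\bigodot^n V[1]$ be the reduced symmetric coalgebra cogenerated by $V[1]$ (symmetric powers taken with Koszul signs), and write $\mathrm{pr}\colon \overline S(V[1])\to V[1]$ for the projection. For a linear map $F$ with values in $\overline S(V[1])$ put $F^1=\mathrm{pr}\circ F$. An $L_\infty$-algebra structure on $V$ is a sequence of degree $1$ linear maps $q_n\colon\bigodot^nV[1]\to V[1]$, $n\ge1$, such that the coderivation $Q$ of $\overline S(V[1])$ with $Q^1=\sum_{n\ge 1}q_n$ satisfies $QQ=0$. An $L_\infty$-morphism from $(C,\hat Q)$ to $(V,Q)$ is a sequence of degree $0$ linear maps $f_n\colon\bigodot^nC[1]\to V[1]$, $n\ge1$, such that the morphism of coalgebras $F\colon\overline S(C[1])\to\overline S(V[1])$ with $F^1=\sum_{n\ge 1}f_n$ satisfies $F\hat Q=QF$. **Theorem.** Let $(V,q_1,q_2,\dots)$ be an $L_\infty$-algebra over $\mathbb K$, let $(C,\delta)$ be a differential complex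 ($\delta$ of degree $1$, $\delta^2=0$), and let $\delta_{[1]}(v_{[1]})=-(\delta v)_{[1]}$ be the suspended differential on $C[1]$. Let $$\imath\colon (C[1],\delta_{[1]})\to (V[1],q_1),\qquad \pi\colon (V[1],q_1)\to (C[1],\delta_{[1]})$$ be morphisms of complexes such that $\imath\pi$ is homotopic to the identity, and let $K\colon V[1]\to V[1]$ be any linear map of degree $-1$ with $q_1K+Kq_1=\imath\pi-\mathrm{Id}_{V[1]}$. Let $q_+=\sum_{n\ge2}q_n$, extended by $0$ to $\bigodot^1V[1]$. In the formulas below $\imath$ and $\delta_{[1]}$ are extended by $0$ to $\bigodot^n C[1]$ for $n\ge 2$. Then: 1. there is exactly one morphism of coalgebras $\imath_\infty\colon\overline S(C[1])\to\overline S(V[1])$ satisfying the recursion $\imath_\infty^1=\imath+Kq_+\imath_\infty$; 2. there is an $L_\infty$-algebra structure $\hat Q$ on $C$, given by $\hat Q^1=\delta_{[1]}+\pi q_+\imath_\infty$, whose linear part is $\delta_{[1]}$ (so it extends the differential complex structure of $C$); 3. $\imath_\infty$ is an $L_\infty$-morphism from $(C,\hat Q)$ to $(V,Q)$, and its linear part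 is $\imath$. -/

import Mathlib

open scoped TensorProduct DirectSum

noncomputable section

namespace LInf

section Algebra

variable {𝕂 : Type*} [Field 𝕂] {W : Type*} [AddCommGroup W] [Module 𝕂 W]

/-- The shifted graded vector space `V[n]`, with `(V[n])^i = V^(i+n)`. A graded vector space is a
vector space together with a direct sum decomposition into subspaces indexed by `ℤ`; the shift has
the same underlying vector space, so that `v ↦ v_[n]` is the identity map. -/
def shift (𝒱 : ℤ → Submodule 𝕂 W) (n : ℤ) : ℤ → Submodule 𝕂 W := fun i => 𝒱 (i + n)

instance shiftDecomposition (𝒱 : ℤ → Submodule 𝕂 W) [DirectSum.Decomposition 𝒱] (n : ℤ) :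
    DirectSum.Decomposition (shift 𝒱 n) := by
  refine DirectSum.IsInternal.chooseDecomposition _ ?_
  rw [DirectSum.isInternal_submodule_iff_iSupIndep_and_iSup_eq_top]
  have h := (DirectSum.isInternal_submodule_iff_iSupIndep_and_iSup_eq_top 𝒱).1
    (DirectSum.Decomposition.isInternal 𝒱)
  refine ⟨h.1.comp (add_left_injective n), ?_⟩
  rw [← h.2]
  exact (Equiv.addRight n).iSup_comp (g := 𝒱)

/-- A linear map of degree `k` between graded vector spaces. -/
def IsOfDegree {W' : Type*} [AddCommGroup W'] [Module 𝕂 W']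
    (𝒲 : ℤ → Submodule 𝕂 W) (𝒲' : ℤ → Submodule 𝕂 W') (k : ℤ) (f : W →ₗ[𝕂] W') : Prop :=
  ∀ (i : ℤ) (w : W), w ∈ 𝒲 i → f w ∈ 𝒲' (i + k)

/-- The relations `v ⊗ w = (-1)^(deg v * deg w) w ⊗ v`, for homogeneous `v` and `w`. -/
inductive SymRel (𝒲 : ℤ → Submodule 𝕂 W) : TensorAlgebra 𝕂 W → TensorAlgebra 𝕂 W → Prop
  | comm {i j : ℤ} {v w : W} (hv : v ∈ 𝒲 i) (hw : w ∈ 𝒲 j) :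
      SymRel 𝒲 (TensorAlgebra.ι 𝕂 v * TensorAlgebra.ι 𝕂 w)
        ((-1 : ℤˣ) ^ (i * j) • (TensorAlgebra.ι 𝕂 w * TensorAlgebra.ι 𝕂 v))

/-- The graded symmetric algebra `⨁_{n ≥ 0} ⊙^n W` of a graded vector space `W`: the quotient of
the tensor algebra by the graded commutativity relations. Its product is `⊙`. -/
def GSym (𝒲 : ℤ → Submodule 𝕂 W) : Type _ := RingQuot (SymRel 𝒲)

namespace GSym

variable (𝒲 : ℤ → Submodule 𝕂 W)

instance : Ring (GSym 𝒲) := inferInstanceAs (Ring (RingQuot (SymRel 𝒲)))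
instance : Algebra 𝕂 (GSym 𝒲) := inferInstanceAs (Algebra 𝕂 (RingQuot (SymRel 𝒲)))

/-- The quotient map from the tensor algebra. -/
def mkHom : TensorAlgebra 𝕂 W →ₐ[𝕂] GSym 𝒲 := RingQuot.mkAlgHom 𝕂 (SymRel 𝒲)

/-- The inclusion `W = ⊙^1 W → ⨁_n ⊙^n W`. -/
def ι : W →ₗ[𝕂] GSym 𝒲 := (mkHom 𝒲).toLinearMap ∘ₗ TensorAlgebra.ι 𝕂

variable {𝒲}

theorem ι_mul_ι {i j : ℤ} {v w : W} (hv : v ∈ 𝒲 i) (hw : w ∈ 𝒲 j) :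
    ι 𝒲 v * ι 𝒲 w = (-1 : ℤˣ) ^ (i * j) • (ι 𝒲 w * ι 𝒲 v) := by
  have h := RingQuot.mkAlgHom_rel 𝕂 (SymRel.comm hv hw)
  rw [map_mul, Units.smul_def, map_zsmul, map_mul] at h
  rw [Units.smul_def]
  exact h

variable {A : Type*} [Ring A] [Algebra 𝕂 A]

/-- The universal property of the graded symmetric algebra. -/
def lift (f : W →ₗ[𝕂] A)
    (hf : ∀ (i j : ℤ) (v w : W), v ∈ 𝒲 i → w ∈ 𝒲 j →
      f v * f w = (-1 : ℤˣ) ^ (i * j) • (f w * f v)) : GSym 𝒲 →ₐ[𝕂] A :=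
  RingQuot.liftAlgHom 𝕂 ⟨TensorAlgebra.lift 𝕂 f, by
    rintro _ _ ⟨hv, hw⟩
    rw [map_mul, Units.smul_def, map_zsmul, map_mul, ← Units.smul_def]
    simpa only [TensorAlgebra.lift_ι_apply] using hf _ _ _ _ hv hw⟩

@[simp]
theorem lift_ι (f : W →ₗ[𝕂] A) (hf) (w : W) : lift (𝒲 := 𝒲) f hf (ι 𝒲 w) = f w := by
  have : lift (𝒲 := 𝒲) f hf (RingQuot.mkAlgHom 𝕂 (SymRel 𝒲) (TensorAlgebra.ι 𝕂 w)) =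
      TensorAlgebra.lift 𝕂 f (TensorAlgebra.ι 𝕂 w) := RingQuot.liftAlgHom_mkAlgHom_apply _ _ _ _
  rw [TensorAlgebra.lift_ι_apply] at this
  exact this

theorem hom_ext {f g : GSym 𝒲 →ₐ[𝕂] A} (h : ∀ w, f (ι 𝒲 w) = g (ι 𝒲 w)) : f = g := by
  apply RingQuot.ringQuot_ext'
  apply TensorAlgebra.hom_ext
  ext w
  exact h w

theorem adjoin_range_ι : Algebra.adjoin 𝕂 (Set.range (ι 𝒲)) = ⊤ := by
  have h : Set.range (ι 𝒲) = mkHom 𝒲 '' Set.range (TensorAlgebra.ι 𝕂 (M := W)) := by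
    rw [← Set.range_comp]
    rfl
  have hs : Function.Surjective (mkHom 𝒲) := RingQuot.mkAlgHom_surjective 𝕂 (SymRel 𝒲)
  rw [h, ← AlgHom.map_adjoin, TensorAlgebra.adjoin_range_ι, Algebra.map_top]
  exact (AlgHom.range_eq_top _).2 hs

variable (𝒲)

/-- The projection onto `⊙^0 W = 𝕂`. -/
def counit : GSym 𝒲 →ₐ[𝕂] 𝕂 := lift 0 (by simp)

@[simp]
theorem counit_ι (w : W) : counit 𝒲 (ι 𝒲 w) = 0 := by simp [counit]

/-- The underlying space `⨁_{n ≥ 1} ⊙^n W` of the reduced symmetric coalgebra cogenerated by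
`W`. -/
def Reduced : Submodule 𝕂 (GSym 𝒲) := LinearMap.ker (counit 𝒲).toLinearMap

/-- The projection `⨁_{n ≥ 0} ⊙^n W → ⨁_{n ≥ 1} ⊙^n W`. -/
def toReduced : GSym 𝒲 →ₗ[𝕂] Reduced 𝒲 :=
  (LinearMap.id - Algebra.linearMap 𝕂 (GSym 𝒲) ∘ₗ (counit 𝒲).toLinearMap).codRestrict
    (Reduced 𝒲) fun x => by simp [Reduced]

@[simp]
theorem coe_toReduced (x : GSym 𝒲) :
    (toReduced 𝒲 x : GSym 𝒲) = x - algebraMap 𝕂 (GSym 𝒲) (counit 𝒲 x) := rfl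

/-- The inclusion `W = ⊙^1 W → ⨁_{n ≥ 1} ⊙^n W`. -/
def incl : W →ₗ[𝕂] Reduced 𝒲 :=
  (ι 𝒲).codRestrict (Reduced 𝒲) fun w => by simp [Reduced]

@[simp]
theorem coe_incl (w : W) : (incl 𝒲 w : GSym 𝒲) = ι 𝒲 w := rfl

/-- The square-zero action of `GSym 𝒲` on `𝕂 × W` in which `w` acts by `(a, u) ↦ (0, a w)`; an
auxiliary construction for the projection onto `⊙^1 W`. -/
def linAct : GSym 𝒲 →ₐ[𝕂] Module.End 𝕂 (𝕂 × W) :=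
  lift { toFun := fun w => LinearMap.inr 𝕂 𝕂 W ∘ₗ LinearMap.toSpanSingleton 𝕂 W w ∘ₗ
          LinearMap.fst 𝕂 𝕂 W
         map_add' := fun v w => by ext <;> simp
         map_smul' := fun a w => by ext <;> simp } (by
    intro i j v w _ _
    have h : ∀ v w : W, (LinearMap.inr 𝕂 𝕂 W ∘ₗ LinearMap.toSpanSingleton 𝕂 W v ∘ₗ
        LinearMap.fst 𝕂 𝕂 W : Module.End 𝕂 (𝕂 × W)) * (LinearMap.inr 𝕂 𝕂 W ∘ₗ
          LinearMap.toSpanSingleton 𝕂 W w ∘ₗ LinearMap.fst 𝕂 𝕂 W) = 0 := by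
      intro v w
      ext <;> simp
    simp only [LinearMap.coe_mk, AddHom.coe_mk, h, smul_zero])

/-- The projection `⨁_{n ≥ 1} ⊙^n W → ⊙^1 W = W`; see `pr_incl` and `pr_mul`. -/
def pr : Reduced 𝒲 →ₗ[𝕂] W :=
  LinearMap.snd 𝕂 𝕂 W ∘ₗ LinearMap.applyₗ ((1, 0) : 𝕂 × W) ∘ₗ (linAct 𝒲).toLinearMap ∘ₗ
    (Reduced 𝒲).subtype

variable {𝒲}

theorem linAct_ι (w : W) (p : 𝕂 × W) : linAct 𝒲 (ι 𝒲 w) p = (0, p.1 • w) := by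
  rw [linAct, lift_ι]
  rfl

theorem pr_incl (w : W) : pr 𝒲 (incl 𝒲 w) = w :=
  (congrArg Prod.snd (linAct_ι w ((1, 0) : 𝕂 × W))).trans (one_smul 𝕂 w)

theorem fst_linAct (x : GSym 𝒲) (p : 𝕂 × W) : (linAct 𝒲 x p).1 = counit 𝒲 x * p.1 := by
  have hx : x ∈ Algebra.adjoin 𝕂 (Set.range (ι 𝒲)) := adjoin_range_ι (𝒲 := 𝒲) ▸ trivial
  induction hx using Algebra.adjoin_induction generalizing p with
  | mem x hx => obtain ⟨w, rfl⟩ := hx; simp [linAct_ι]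
  | algebraMap r => simp [AlgHom.commutes, Module.algebraMap_end_apply]
  | add x y _ _ hx hy => simp [hx, hy, add_mul]
  | mul x y _ _ hx hy => simp [hx, hy, mul_assoc]

theorem linAct_inr (x : GSym 𝒲) (u : W) : linAct 𝒲 x (0, u) = (0, counit 𝒲 x • u) := by
  have hx : x ∈ Algebra.adjoin 𝕂 (Set.range (ι 𝒲)) := adjoin_range_ι (𝒲 := 𝒲) ▸ trivial
  induction hx using Algebra.adjoin_induction generalizing u with
  | mem x hx => obtain ⟨w, rfl⟩ := hx; simp [linAct_ι]
  | algebraMap r => simp [AlgHom.commutes, Module.algebraMap_end_apply]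
  | add x y _ _ hx hy => simp [hx, hy, add_smul]
  | mul x y _ _ hx hy => simp [hx, hy, mul_smul]

theorem pr_mul (x y : Reduced 𝒲) (h : (x : GSym 𝒲) * y ∈ Reduced 𝒲) :
    pr 𝒲 ⟨(x : GSym 𝒲) * y, h⟩ = 0 := by
  have hx : counit 𝒲 (x : GSym 𝒲) = 0 := x.2
  have hy : counit 𝒲 (y : GSym 𝒲) = 0 := y.2
  have h1 : linAct 𝒲 (y : GSym 𝒲) (1, 0) = (0, (linAct 𝒲 (y : GSym 𝒲) (1, 0)).2) :=
    Prod.ext ((fst_linAct _ _).trans (by rw [hy, zero_mul])) rfl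
  change (linAct 𝒲 ((x : GSym 𝒲) * y) (1, 0)).2 = 0
  rw [map_mul, Module.End.mul_apply, h1, linAct_inr, hx, zero_smul]

variable (𝒲)

/-- The degree `k` component of the graded symmetric algebra, spanned by the products
`v₁ ⊙ ⋯ ⊙ vₙ` of homogeneous elements of `W` whose degrees sum to `k`. -/
def deg (k : ℤ) : Submodule 𝕂 (GSym 𝒲) :=
  Submodule.span 𝕂 {x | ∃ l : List (ℤ × W), (∀ p ∈ l, p.2 ∈ 𝒲 p.1) ∧
    (l.map Prod.fst).sum = k ∧ x = (l.map fun p => ι 𝒲 p.2).prod}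

variable {𝒲}

theorem ι_mem_deg {i : ℤ} {w : W} (hw : w ∈ 𝒲 i) : ι 𝒲 w ∈ deg 𝒲 i :=
  Submodule.subset_span ⟨[(i, w)], by simpa using hw, by simp, by simp⟩

instance : SetLike.GradedMonoid (deg 𝒲) where
  one_mem := Submodule.subset_span ⟨[], by simp, by simp, by simp⟩
  mul_mem := by
    intro i j x y hx hy
    have h : deg 𝒲 i * deg 𝒲 j ≤ deg 𝒲 (i + j) := by
      rw [deg, deg, Submodule.span_mul_span]
      apply Submodule.span_mono
      rintro _ ⟨_, ⟨l, hl, rfl, rfl⟩, _, ⟨m, hm, rfl, rfl⟩, rfl⟩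
      refine ⟨l ++ m, fun p hp => ?_, by simp, by simp⟩
      rcases List.mem_append.1 hp with hp | hp
      exacts [hl p hp, hm p hp]
    exact h (Submodule.mul_mem_mul hx hy)

variable (𝒲) [DirectSum.Decomposition 𝒲]

/-- The inclusion of `W` into the direct sum of the homogeneous components of `GSym 𝒲`; an
auxiliary construction for the grading. -/
def gradedι : W →ₗ[𝕂] ⨁ i, deg 𝒲 i :=
  DirectSum.toModule 𝕂 ℤ _ (fun i => DirectSum.lof 𝕂 ℤ (fun i => deg 𝒲 i) i ∘ₗ
    ((ι 𝒲).restrict fun _ hw => ι_mem_deg hw)) ∘ₗ (DirectSum.decomposeLinearEquiv 𝒲).toLinearMap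

variable {𝒲}

theorem gradedι_apply {i : ℤ} {w : W} (hw : w ∈ 𝒲 i) :
    gradedι 𝒲 w = DirectSum.of (fun i => deg 𝒲 i) i ⟨ι 𝒲 w, ι_mem_deg hw⟩ := by
  rw [gradedι, LinearMap.comp_apply]
  simp only [LinearEquiv.coe_coe, DirectSum.decomposeLinearEquiv_apply]
  rw [DirectSum.decompose_of_mem 𝒲 hw, ← DirectSum.lof_eq_of 𝕂, DirectSum.toModule_lof]
  rfl

theorem gradedι_mul {i j : ℤ} {v w : W} (hv : v ∈ 𝒲 i) (hw : w ∈ 𝒲 j) :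
    gradedι 𝒲 v * gradedι 𝒲 w = (-1 : ℤˣ) ^ (i * j) • (gradedι 𝒲 w * gradedι 𝒲 v) := by
  rw [gradedι_apply hv, gradedι_apply hw, DirectSum.of_mul_of, DirectSum.of_mul_of,
    Units.smul_def, ← map_zsmul (DirectSum.of (fun i => deg 𝒲 i) (j + i))]
  refine DirectSum.of_eq_of_gradedMonoid_eq (Sigma.subtype_ext (add_comm i j) ?_)
  have h := ι_mul_ι hv hw
  rw [Units.smul_def] at h
  exact h

/-- The algebra morphism splitting an element into its homogeneous components; an auxiliary
construction for the grading. -/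
def toGraded (𝒲 : ℤ → Submodule 𝕂 W) [DirectSum.Decomposition 𝒲] :
    GSym 𝒲 →ₐ[𝕂] ⨁ i, deg 𝒲 i :=
  letI : Ring (⨁ i, deg 𝒲 i) := DirectSum.ring _
  lift (A := ⨁ i, deg 𝒲 i) (gradedι 𝒲) fun _ _ _ _ => gradedι_mul

theorem toGraded_ι (w : W) : toGraded 𝒲 (ι 𝒲 w) = gradedι 𝒲 w :=
  letI : Ring (⨁ i, deg 𝒲 i) := DirectSum.ring _
  lift_ι (A := ⨁ i, deg 𝒲 i) _ _ w

/-- The homogeneous components make the graded symmetric algebra a graded algebra. -/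
instance gradedAlgebra : GradedAlgebra (deg 𝒲) :=
  GradedAlgebra.ofAlgHom (deg 𝒲) (toGraded 𝒲)
    (by
      apply hom_ext
      intro w
      rw [AlgHom.comp_apply, toGraded_ι, AlgHom.id_apply]
      induction w using DirectSum.Decomposition.inductionOn 𝒲 with
      | zero => simp
      | @homogeneous i w => rw [gradedι_apply w.2, DirectSum.coeAlgHom_of]
      | add v w hv hw => rw [map_add, map_add, map_add, hv, hw])
    (by
      rintro k ⟨x, hx⟩
      induction hx using Submodule.span_induction with
      | mem x h =>
        obtain ⟨l, hl, rfl, rfl⟩ := h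
        induction l with
        | nil => exact map_one _
        | cons p l ih =>
          have hl' : ∀ q ∈ l, q.2 ∈ 𝒲 q.1 := fun q hq => hl q (List.mem_cons_of_mem _ hq)
          simp only [List.map_cons, List.prod_cons, map_mul, toGraded_ι]
          rw [ih hl', gradedι_apply (hl p List.mem_cons_self), DirectSum.of_mul_of]
          exact DirectSum.of_eq_of_gradedMonoid_eq (Sigma.subtype_ext rfl rfl)
      | zero =>
        dsimp only
        rw [map_zero]
        exact (map_zero (DirectSum.of (fun i => deg 𝒲 i) k)).symm
      | add x y hx hy ihx ihy =>
        dsimp only at ihx ihy ⊢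
        rw [map_add, ihx, ihy, ← map_add]
        rfl
      | smul a x hx ih =>
        dsimp only at ih ⊢
        rw [map_smul, ih, ← DirectSum.lof_eq_of 𝕂, ← DirectSum.lof_eq_of 𝕂, ← map_smul]
        rfl)

variable (𝒲)

open GradedTensorProduct in
/-- The coproduct of the graded symmetric algebra, as a morphism of algebras: it is the
multiplicative extension of `w ↦ w ⊗ 1 + 1 ⊗ w`, where `GSym 𝒲 ⊗ GSym 𝒲` has the product
`(a ⊗ b) (c ⊗ d) = (-1)^(deg b * deg c) (a ⊙ c) ⊗ (b ⊙ d)`. -/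
def comulAlgHom : GSym 𝒲 →ₐ[𝕂] GradedTensorProduct 𝕂 (deg 𝒲) (deg 𝒲) :=
  lift ((includeLeft (deg 𝒲) (deg 𝒲)).toLinearMap ∘ₗ ι 𝒲 +
      (includeRight (deg 𝒲) (deg 𝒲)).toLinearMap ∘ₗ ι 𝒲) (by
    intro i j v w hv hw
    have h : ∀ {i j : ℤ} {v w : W}, v ∈ 𝒲 i → w ∈ 𝒲 j →
        (tmul 𝕂 (1 : GSym 𝒲) (ι 𝒲 v) : GradedTensorProduct 𝕂 (deg 𝒲) (deg 𝒲)) *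
          tmul 𝕂 (ι 𝒲 w) (1 : GSym 𝒲) = (-1 : ℤˣ) ^ (i * j) • tmul 𝕂 (ι 𝒲 w) (ι 𝒲 v) := by
      intro i j v w hv hw
      have := tmul_coe_mul_coe_tmul (R := 𝕂) (deg 𝒲) (deg 𝒲) 1 (⟨_, ι_mem_deg hv⟩ : deg 𝒲 i)
        (⟨_, ι_mem_deg hw⟩ : deg 𝒲 j) 1
      rw [one_mul, mul_one] at this
      exact this
    have h1 := congrArg (includeLeft (R := 𝕂) (deg 𝒲) (deg 𝒲)) (ι_mul_ι hv hw)
    have h2 := congrArg (includeRight (R := 𝕂) (deg 𝒲) (deg 𝒲)) (ι_mul_ι hv hw)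
    rw [Units.smul_def, map_zsmul, ← Units.smul_def, map_mul, map_mul] at h1 h2
    simp only [LinearMap.add_apply, LinearMap.comp_apply, AlgHom.toLinearMap_apply, mul_add,
      add_mul, smul_add, h1, h2]
    simp only [includeLeft_apply, includeRight_apply, h hv hw, h hw hv, tmul_one_mul_one_tmul]
    rw [smul_smul, mul_comm j i, Int.units_mul_self, one_smul]
    abel)

/-- The coproduct `v₁ ⊙ ⋯ ⊙ vₙ ↦ ∑_k ∑_σ ε(σ) (v_σ(1) ⊙ ⋯ ⊙ v_σ(k)) ⊗ (v_σ(k+1) ⊙ ⋯ ⊙ v_σ(n))`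
(`0 ≤ k ≤ n`, with `σ` in the set of unshuffles `S(k, n-k)`) of the graded symmetric algebra. -/
def comul : GSym 𝒲 →ₗ[𝕂] GSym 𝒲 ⊗[𝕂] GSym 𝒲 :=
  (GradedTensorProduct.of 𝕂 (deg 𝒲) (deg 𝒲)).symm.toLinearMap ∘ₗ (comulAlgHom 𝒲).toLinearMap

/-- The grading of `⨁_{n ≥ 1} ⊙^n W` by the total degree. -/
def redDeg (k : ℤ) : Submodule 𝕂 (Reduced 𝒲) := (deg 𝒲 k).comap (Reduced 𝒲).subtype

/-- The coproduct `v₁ ⊙ ⋯ ⊙ vₙ ↦ ∑_k ∑_σ ε(σ) (v_σ(1) ⊙ ⋯ ⊙ v_σ(k)) ⊗ (v_σ(k+1) ⊙ ⋯ ⊙ v_σ(n))`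
(`1 ≤ k ≤ n - 1`, `σ ∈ S(k, n-k)`) of the reduced symmetric coalgebra. -/
def redComul : Reduced 𝒲 →ₗ[𝕂] Reduced 𝒲 ⊗[𝕂] Reduced 𝒲 :=
  TensorProduct.map (toReduced 𝒲) (toReduced 𝒲) ∘ₗ comul 𝒲 ∘ₗ (Reduced 𝒲).subtype

variable {𝒲}

/-- The coderivation of the reduced symmetric coalgebra induced by `q = ∑_{k ≥ 1} q_k`, that is
`v₁ ⊙ ⋯ ⊙ vₙ ↦ ∑_{k ≥ 1} ∑_σ ε(σ) q_k(v_σ(1) ⊙ ⋯ ⊙ v_σ(k)) ⊙ v_σ(k+1) ⊙ ⋯ ⊙ v_σ(n)`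
(`1 ≤ k ≤ n`, `σ ∈ S(k, n-k)`): apply the coproduct, then `q` to the left factor (extended by `0`
to `⊙^0 W`), and multiply. -/
def coderivation (q : Reduced 𝒲 →ₗ[𝕂] W) : Reduced 𝒲 →ₗ[𝕂] Reduced 𝒲 :=
  toReduced 𝒲 ∘ₗ LinearMap.mul' 𝕂 (GSym 𝒲) ∘ₗ
    TensorProduct.map (ι 𝒲 ∘ₗ q ∘ₗ toReduced 𝒲) LinearMap.id ∘ₗ comul 𝒲 ∘ₗ (Reduced 𝒲).subtype

/-- A morphism of coalgebras between reduced symmetric coalgebras. -/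
def IsCoalgebraHom {W' : Type*} [AddCommGroup W'] [Module 𝕂 W'] {𝒲' : ℤ → Submodule 𝕂 W'}
    [DirectSum.Decomposition 𝒲'] (F : Reduced 𝒲 →ₗ[𝕂] Reduced 𝒲') : Prop :=
  redComul 𝒲' ∘ₗ F = TensorProduct.map F F ∘ₗ redComul 𝒲

end GSym

end Algebra

section LInfinity

variable {𝕂 : Type*} [Field 𝕂]
  {V : Type*} [AddCommGroup V] [Module 𝕂 V]
  {C : Type*} [AddCommGroup C] [Module 𝕂 C]

open GSym

/-- An `L_∞`-algebra structure on a graded vector space `V`: a sequence of linear maps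
`q_k : ⊙^k V[1] → V[1]`, `k ≥ 1`, of degree `1`, given through their sum
`q = ∑_k q_k : ⨁_{k ≥ 1} ⊙^k V[1] → V[1]`, such that the induced coderivation `Q` satisfies
`Q Q = 0`. -/
structure LInftyAlgebra (𝒱 : ℤ → Submodule 𝕂 V) [DirectSum.Decomposition 𝒱] where
  q : Reduced (shift 𝒱 1) →ₗ[𝕂] V
  isOfDegree_q : IsOfDegree (redDeg (shift 𝒱 1)) (shift 𝒱 1) 1 q
  coderivation_sq : coderivation q ∘ₗ coderivation q = 0

namespace LInftyAlgebra

variable {𝒱 : ℤ → Submodule 𝕂 V} [DirectSum.Decomposition 𝒱] (L : LInftyAlgebra 𝒱)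

/-- The codifferential `Q`. -/
def Q : Reduced (shift 𝒱 1) →ₗ[𝕂] Reduced (shift 𝒱 1) := coderivation L.q

/-- The linear part `q₁ : V[1] → V[1]`. -/
def q₁ : V →ₗ[𝕂] V := L.q ∘ₗ incl (shift 𝒱 1)

/-- The sum `q₊ = ∑_{n ≥ 2} q_n`, extended by `0` to `⊙^1 V[1]`. -/
def qPlus : Reduced (shift 𝒱 1) →ₗ[𝕂] V :=
  L.q ∘ₗ (LinearMap.id - incl (shift 𝒱 1) ∘ₗ pr (shift 𝒱 1))

end LInftyAlgebra

/-- An `L_∞`-morphism `A → B`: a sequence of linear maps `f_n : ⊙^n C[1] → V[1]`, `n ≥ 1`, of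
degree `0`, given through their sum `f = ∑_n f_n`, such that the induced morphism of coalgebras
`F` (the one with `pr ∘ F = f`) commutes with the codifferentials. -/
structure LInftyHom {𝒞 : ℤ → Submodule 𝕂 C} [DirectSum.Decomposition 𝒞]
    {𝒱 : ℤ → Submodule 𝕂 V} [DirectSum.Decomposition 𝒱]
    (A : LInftyAlgebra 𝒞) (B : LInftyAlgebra 𝒱) where
  f : Reduced (shift 𝒞 1) →ₗ[𝕂] V
  isOfDegree_f : IsOfDegree (redDeg (shift 𝒞 1)) (shift 𝒱 1) 0 f
  F : Reduced (shift 𝒞 1) →ₗ[𝕂] Reduced (shift 𝒱 1)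
  isCoalgebraHom_F : IsCoalgebraHom F
  pr_F : pr (shift 𝒱 1) ∘ₗ F = f
  comm : F ∘ₗ A.Q = B.Q ∘ₗ F

/-- The linear part `f₁ : C[1] → V[1]` of an `L_∞`-morphism. -/
def LInftyHom.f₁ {𝒞 : ℤ → Submodule 𝕂 C} [DirectSum.Decomposition 𝒞]
    {𝒱 : ℤ → Submodule 𝕂 V} [DirectSum.Decomposition 𝒱]
    {A : LInftyAlgebra 𝒞} {B : LInftyAlgebra 𝒱} (Φ : LInftyHom A B) : C →ₗ[𝕂] V :=
  Φ.f ∘ₗ incl (shift 𝒞 1)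

/-- The suspension `δ_[1] : C[1] → C[1]` of a map `δ` of degree `1`: `v_[1] ↦ -(δ v)_[1]`. -/
def suspend (δ : C →ₗ[𝕂] C) : C →ₗ[𝕂] C := -δ

end LInfinity

end LInf

end

/-! Write `F` for the morphism sought, `E` for the Euler coderivation (multiplication by `n` on
words of length `n`) and `T = K q₊`. The mechanism is that `T` vanishes on `⊙^1`, so an equation `pr
D = T D` sees only the part of `D` of length at least two.

Vanishing principle (`eq_zero_of_redComul`): let `D` be a coderivation along maps `A`, `B`, with `pr
D = T D`. By induction on word length the reduced coproduct of `D x` vanishes, so `D x` is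
primitive; in characteristic `0` primitives lie in `⊙^1`, where `T` is zero, hence `pr (D x) = 0`
and `D x = 0`. Applied to the difference of two solutions this gives uniqueness
(`IsCoalgebraHom.eq_of_pr_comp`); applied to `F Q̂ - Q F` it gives the morphism property
(`IsCoalgebraHom.comp_coderivation`); with `T = 0` and `D = Q̂ Q̂` it gives
`coderivation_sq_eq_zero`.

The hypotheses enter only through linear components. The identity `q₁ q₊ + q₊ Q = 0`
(`LInftyAlgebra.q₁_qPlus`) and the homotopy formula give `pr (F Q̂ - Q F) = K q₊ (F Q̂ - Q F)`. Once
`F Q̂ = Q F` is known, `q̂ Q̂ = δ π q₊ F + π q₊ Q F = π (q₁ q₊ + q₊ Q) F = 0`, with `δ` the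
suspended differential.

Existence (`exists_isCoalgebraHom`): a coalgebra morphism with linear component `f` is the
convolution exponential of `f`, characterised by `F E = (f E) * F`. Dividing by `n` on length `n`
makes this a recursion on length, solved by a fixed point argument (`exists_fixedPoint`). The same
equation shows that the solution respects coproducts (`comul_comp_unital`). -/

noncomputable section

namespace LInf

/-! ### Graded linear maps and Koszul signs. -/

section Graded

variable {𝕂 : Type*} [Field 𝕂] {W : Type*} [AddCommGroup W] [Module 𝕂 W]
  {N : Type*} [AddCommGroup N] [Module 𝕂 N] (𝒲 : ℤ → Submodule 𝕂 W) [DirectSum.Decomposition 𝒲]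

/-- The linear map given by `φ i` on the component of degree `i`. -/
def gradedLift (φ : ℤ → W →ₗ[𝕂] N) : W →ₗ[𝕂] N :=
  DirectSum.toModule 𝕂 ℤ N (fun i => φ i ∘ₗ (𝒲 i).subtype) ∘ₗ
    (DirectSum.decomposeLinearEquiv 𝒲).toLinearMap

variable {𝒲}

theorem gradedLift_apply (φ : ℤ → W →ₗ[𝕂] N) {i : ℤ} {w : W} (hw : w ∈ 𝒲 i) :
    gradedLift 𝒲 φ w = φ i w := by
  rw [gradedLift, LinearMap.comp_apply]
  simp only [LinearEquiv.coe_coe, DirectSum.decomposeLinearEquiv_apply]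
  rw [DirectSum.decompose_of_mem 𝒲 hw, ← DirectSum.lof_eq_of 𝕂, DirectSum.toModule_lof]
  rfl

theorem homogeneous_ext {A B : W →ₗ[𝕂] N} (h : ∀ i, ∀ w ∈ 𝒲 i, A w = B w) : A = B := by
  ext w
  induction w using DirectSum.Decomposition.inductionOn 𝒲 with
  | zero => simp
  | @homogeneous i w => exact h i w w.2
  | add v w hv hw => rw [map_add, map_add, hv, hw]

theorem tensor_homogeneous_ext {M : Type*} [AddCommGroup M] [Module 𝕂 M]
    {A B : W ⊗[𝕂] M →ₗ[𝕂] N} (h : ∀ i, ∀ w ∈ 𝒲 i, ∀ m, A (w ⊗ₜ m) = B (w ⊗ₜ m)) : A = B := by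
  apply TensorProduct.ext
  apply homogeneous_ext (𝒲 := 𝒲)
  intro i w hw
  ext m
  exact h i w hw m

theorem sgn_mul (m n : ℤ) : (-1 : 𝕂) ^ m * (-1 : 𝕂) ^ n = (-1) ^ (m + n) :=
  (zpow_add₀ (by simp) m n).symm

theorem sgn_congr {m n : ℤ} (h : Even (m - n)) : (-1 : 𝕂) ^ m = (-1) ^ n := by
  rw [← sub_add_cancel m n, ← sgn_mul, h.neg_one_zpow, one_mul]

theorem units_smul_eq (n : ℤ) (w : W) : ((-1 : ℤˣ) ^ n) • w = (-1 : 𝕂) ^ n • w := by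
  rcases Int.even_or_odd n with h | h
  · rw [h.neg_one_zpow, h.neg_one_zpow, one_smul, one_smul]
  · rw [h.neg_one_zpow, h.neg_one_zpow, neg_smul, one_smul, Units.smul_def]
    simp

variable (𝒲)

/-- The operator multiplying the component of degree `i` by `(-1) ^ (k * i)`. -/
def twist (k : ℤ) : W →ₗ[𝕂] W := gradedLift 𝒲 fun i => (-1 : 𝕂) ^ (k * i) • LinearMap.id

variable {𝒲}

theorem twist_apply {k i : ℤ} {w : W} (hw : w ∈ 𝒲 i) : twist 𝒲 k w = (-1 : 𝕂) ^ (k * i) • w := by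
  rw [twist, gradedLift_apply _ hw]
  rfl

theorem twist_comp_twist (k l : ℤ) : twist 𝒲 k ∘ₗ twist 𝒲 l = twist 𝒲 (k + l) := by
  apply homogeneous_ext (𝒲 := 𝒲)
  intro i w hw
  rw [LinearMap.comp_apply, twist_apply hw, map_smul, twist_apply hw, twist_apply hw, smul_smul,
    sgn_mul]
  ring_nf

theorem twist_of_even {k : ℤ} (hk : Even k) : twist 𝒲 k = LinearMap.id := by
  apply homogeneous_ext (𝒲 := 𝒲)
  intro i w hw
  rw [twist_apply hw, (hk.mul_right i).neg_one_zpow, one_smul, LinearMap.id_apply]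

variable {W' : Type*} [AddCommGroup W'] [Module 𝕂 W'] {𝒲' : ℤ → Submodule 𝕂 W'}
  [DirectSum.Decomposition 𝒲']

theorem IsOfDegree.twist_comp {k d : ℤ} {f : W →ₗ[𝕂] W'} (hf : IsOfDegree 𝒲 𝒲' d f) :
    twist 𝒲' k ∘ₗ f = (-1 : 𝕂) ^ (k * d) • (f ∘ₗ twist 𝒲 k) := by
  apply homogeneous_ext (𝒲 := 𝒲)
  intro i w hw
  rw [LinearMap.comp_apply, twist_apply (hf i w hw), LinearMap.smul_apply, LinearMap.comp_apply,
    twist_apply hw, map_smul, smul_smul, sgn_mul]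
  ring_nf

end Graded

section Degree

variable {𝕂 : Type*} [Field 𝕂] {W : Type*} [AddCommGroup W] [Module 𝕂 W]
  {W' : Type*} [AddCommGroup W'] [Module 𝕂 W'] {W'' : Type*} [AddCommGroup W''] [Module 𝕂 W'']
  {𝒲 : ℤ → Submodule 𝕂 W} {𝒲' : ℤ → Submodule 𝕂 W'} {𝒲'' : ℤ → Submodule 𝕂 W''}

theorem IsOfDegree.comp {a b c : ℤ} {g : W' →ₗ[𝕂] W''} {f : W →ₗ[𝕂] W'}
    (hg : IsOfDegree 𝒲' 𝒲'' b g) (hf : IsOfDegree 𝒲 𝒲' a f) (h : a + b = c) :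
    IsOfDegree 𝒲 𝒲'' c (g ∘ₗ f) := by
  intro i w hw
  rw [← h, ← add_assoc]
  exact hg _ _ (hf _ _ hw)

theorem IsOfDegree.add {a : ℤ} {f g : W →ₗ[𝕂] W'} (hf : IsOfDegree 𝒲 𝒲' a f)
    (hg : IsOfDegree 𝒲 𝒲' a g) : IsOfDegree 𝒲 𝒲' a (f + g) :=
  fun i w hw => add_mem (hf i w hw) (hg i w hw)

theorem IsOfDegree.sub {a : ℤ} {f g : W →ₗ[𝕂] W'} (hf : IsOfDegree 𝒲 𝒲' a f)
    (hg : IsOfDegree 𝒲 𝒲' a g) : IsOfDegree 𝒲 𝒲' a (f - g) :=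
  fun i w hw => sub_mem (hf i w hw) (hg i w hw)

theorem IsOfDegree.zero (a : ℤ) : IsOfDegree 𝒲 𝒲' a (0 : W →ₗ[𝕂] W') :=
  fun _ _ _ => zero_mem _

theorem IsOfDegree.id : IsOfDegree 𝒲 𝒲 0 (LinearMap.id : W →ₗ[𝕂] W) :=
  fun i w hw => by rwa [add_zero]

end Degree

/-! ### Words, the length filtration and the coproduct. -/

namespace GSym

variable {𝕂 : Type*} [Field 𝕂] {W : Type*} [AddCommGroup W] [Module 𝕂 W]
  {N : Type*} [AddCommGroup N] [Module 𝕂 N] (𝒲 : ℤ → Submodule 𝕂 W)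

/-- Products of `n` homogeneous elements of `W` whose degrees sum to `k`. -/
inductive IsWord : ℕ → ℤ → GSym 𝒲 → Prop
  | one : IsWord 0 0 1
  | mul {n : ℕ} {i k : ℤ} {w : W} {x : GSym 𝒲} (hw : w ∈ 𝒲 i) (hx : IsWord n k x) :
      IsWord (n + 1) (i + k) (ι 𝒲 w * x)

/-- The subspace `⨁_{m ≤ n} ⊙^m W`. -/
def filt (n : ℕ) : Submodule 𝕂 (GSym 𝒲) :=
  Submodule.span 𝕂 {x | ∃ m ≤ n, ∃ k, IsWord 𝒲 m k x}

variable {𝒲}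

theorem filt_mono {m n : ℕ} (h : m ≤ n) : filt 𝒲 m ≤ filt 𝒲 n :=
  Submodule.span_mono fun _ ⟨l, hl, hx⟩ => ⟨l, hl.trans h, hx⟩

theorem IsWord.mem_filt {n : ℕ} {k : ℤ} {x : GSym 𝒲} (h : IsWord 𝒲 n k x) : x ∈ filt 𝒲 n :=
  Submodule.subset_span ⟨n, le_rfl, k, h⟩

theorem IsWord.mem_deg {n : ℕ} {k : ℤ} {x : GSym 𝒲} (h : IsWord 𝒲 n k x) : x ∈ deg 𝒲 k := by
  induction h with
  | one => exact SetLike.GradedOne.one_mem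
  | mul hw _ ih => exact SetLike.GradedMul.mul_mem (ι_mem_deg hw) ih

theorem isWord_of_list (l : List (ℤ × W)) (hl : ∀ p ∈ l, p.2 ∈ 𝒲 p.1) :
    IsWord 𝒲 l.length (l.map Prod.fst).sum (l.map fun p => ι 𝒲 p.2).prod := by
  induction l with
  | nil => exact IsWord.one
  | cons p l ih =>
    simp only [List.map_cons, List.sum_cons, List.prod_cons, List.length_cons]
    exact IsWord.mul (hl p List.mem_cons_self) (ih fun q hq => hl q (List.mem_cons_of_mem _ hq))

theorem deg_eq_span (k : ℤ) : deg 𝒲 k = Submodule.span 𝕂 {x | ∃ n, IsWord 𝒲 n k x} := by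
  apply le_antisymm
  · apply Submodule.span_le.2
    rintro _ ⟨l, hl, rfl, rfl⟩
    exact Submodule.subset_span ⟨_, isWord_of_list l hl⟩
  · apply Submodule.span_le.2
    rintro x ⟨n, hx⟩
    exact hx.mem_deg

theorem ι_mul_mem_filt {i : ℤ} {w : W} (hw : w ∈ 𝒲 i) {n : ℕ} {x : GSym 𝒲} (hx : x ∈ filt 𝒲 n) :
    ι 𝒲 w * x ∈ filt 𝒲 (n + 1) := by
  induction hx using Submodule.span_induction with
  | mem x h =>
    obtain ⟨m, hm, k, hx⟩ := h
    exact Submodule.subset_span ⟨m + 1, by omega, _, IsWord.mul hw hx⟩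
  | zero => rw [mul_zero]; exact zero_mem _
  | add x y _ _ hx hy => rw [mul_add]; exact add_mem hx hy
  | smul a x _ hx => rw [mul_smul_comm]; exact Submodule.smul_mem _ _ hx

variable (𝒲)

/-- Left multiplication by `w`. -/
def mulι (w : W) : GSym 𝒲 →ₗ[𝕂] GSym 𝒲 := LinearMap.mulLeft 𝕂 (ι 𝒲 w)

variable {𝒲}

theorem mulι_apply (w : W) (x : GSym 𝒲) : mulι 𝒲 w x = ι 𝒲 w * x := rfl

theorem isOfDegree_mulι {i : ℤ} {w : W} (hw : w ∈ 𝒲 i) :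
    IsOfDegree (deg 𝒲) (deg 𝒲) i (mulι 𝒲 w) := by
  intro k x hx
  rw [add_comm]
  exact SetLike.GradedMul.mul_mem (ι_mem_deg hw) hx

theorem one_mem_deg : (1 : GSym 𝒲) ∈ deg 𝒲 0 := SetLike.GradedOne.one_mem

section

variable [DirectSum.Decomposition 𝒲]

theorem span_words : Submodule.span 𝕂 {x | ∃ n k, IsWord 𝒲 n k x} = ⊤ := by
  rw [eq_top_iff]
  rintro x -
  induction x using DirectSum.Decomposition.inductionOn (deg 𝒲) with
  | zero => exact zero_mem _
  | @homogeneous k x =>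
    have hx : (x : GSym 𝒲) ∈ Submodule.span 𝕂 {x | ∃ n, IsWord 𝒲 n k x} := (deg_eq_span k).le x.2
    refine Submodule.span_mono ?_ hx
    rintro y ⟨n, hy⟩
    exact ⟨n, k, hy⟩
  | add x y hx hy => exact add_mem hx hy

theorem exists_mem_filt (x : GSym 𝒲) : ∃ n, x ∈ filt 𝒲 n := by
  have hx : x ∈ Submodule.span 𝕂 {x | ∃ n k, IsWord 𝒲 n k x} := by rw [span_words]; trivial
  induction hx using Submodule.span_induction with
  | mem x h => obtain ⟨n, k, h⟩ := h; exact ⟨n, h.mem_filt⟩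
  | zero => exact ⟨0, zero_mem _⟩
  | add x y _ _ hx hy =>
    obtain ⟨m, hm⟩ := hx
    obtain ⟨n, hn⟩ := hy
    exact ⟨max m n, add_mem (filt_mono (le_max_left _ _) hm) (filt_mono (le_max_right _ _) hn)⟩
  | smul a x _ hx => obtain ⟨n, hn⟩ := hx; exact ⟨n, Submodule.smul_mem _ _ hn⟩

/-- Induction on words by prepending one homogeneous letter; the coproduct identities below reduce
to their behaviour under left multiplication by a letter. -/
theorem word_ext {A B : GSym 𝒲 →ₗ[𝕂] N} (h1 : A 1 = B 1)
    (h : ∀ i, ∀ w ∈ 𝒲 i, ∀ x, A x = B x → A (ι 𝒲 w * x) = B (ι 𝒲 w * x)) : A = B := by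
  refine LinearMap.ext_on span_words ?_
  rintro x ⟨n, k, hx⟩
  induction hx with
  | one => exact h1
  | mul hw _ ih => exact h _ _ hw _ ih

theorem ext_of_filt {A B : GSym 𝒲 →ₗ[𝕂] N} (h : ∀ n, ∀ x ∈ filt 𝒲 n, A x = B x) : A = B := by
  ext x
  obtain ⟨n, hn⟩ := exists_mem_filt x
  exact h n x hn

theorem twist_mul {i k : ℤ} {w : W} (hw : w ∈ 𝒲 i) (x : GSym 𝒲) :
    twist (deg 𝒲) k (ι 𝒲 w * x) = (-1 : 𝕂) ^ (k * i) • (ι 𝒲 w * twist (deg 𝒲) k x) :=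
  LinearMap.congr_fun (isOfDegree_mulι hw).twist_comp x

theorem twist_one (k : ℤ) : twist (deg 𝒲) k (1 : GSym 𝒲) = 1 := by
  rw [twist_apply (one_mem_deg (𝒲 := 𝒲)), mul_zero, zpow_zero, one_smul]

theorem twist_mem_filt {k : ℤ} {n : ℕ} {x : GSym 𝒲} (hx : x ∈ filt 𝒲 n) :
    twist (deg 𝒲) k x ∈ filt 𝒲 n := by
  induction hx using Submodule.span_induction with
  | mem x h =>
    obtain ⟨m, hm, l, h⟩ := h
    rw [twist_apply h.mem_deg]
    exact Submodule.smul_mem _ _ (filt_mono hm h.mem_filt)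
  | zero => rw [map_zero]; exact zero_mem _
  | add x y _ _ hx hy => rw [map_add]; exact add_mem hx hy
  | smul a x _ hx => rw [map_smul]; exact Submodule.smul_mem _ _ hx

theorem comul_one : comul 𝒲 1 = 1 ⊗ₜ 1 := by
  rw [comul, LinearMap.comp_apply, AlgHom.toLinearMap_apply, map_one]
  rfl

-- Multiplicativity together with `Δ w = w ⊗ 1 + 1 ⊗ w`; the twist is the Koszul sign for moving `w`
-- past the left factor.
open GradedTensorProduct in
theorem comul_mul {i : ℤ} {w : W} (hw : w ∈ 𝒲 i) (x : GSym 𝒲) :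
    comul 𝒲 (ι 𝒲 w * x) = TensorProduct.map (mulι 𝒲 w) LinearMap.id (comul 𝒲 x) +
      TensorProduct.map (twist (deg 𝒲) i) (mulι 𝒲 w) (comul 𝒲 x) := by
  have key : ∀ t : GSym 𝒲 ⊗[𝕂] GSym 𝒲,
      (of 𝕂 (deg 𝒲) (deg 𝒲)).symm
        ((includeLeft (deg 𝒲) (deg 𝒲) (ι 𝒲 w) + includeRight (deg 𝒲) (deg 𝒲) (ι 𝒲 w)) *
          of 𝕂 (deg 𝒲) (deg 𝒲) t) = TensorProduct.map (mulι 𝒲 w) LinearMap.id t +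
      TensorProduct.map (twist (deg 𝒲) i) (mulι 𝒲 w) t := by
    intro t
    refine LinearMap.congr_fun (f := (of 𝕂 (deg 𝒲) (deg 𝒲)).symm.toLinearMap ∘ₗ
      mulHom (deg 𝒲) (deg 𝒲) (includeLeft (deg 𝒲) (deg 𝒲) (ι 𝒲 w) +
        includeRight (deg 𝒲) (deg 𝒲) (ι 𝒲 w)) ∘ₗ (of 𝕂 (deg 𝒲) (deg 𝒲)).toLinearMap)
      (g := TensorProduct.map (mulι 𝒲 w) LinearMap.id +
        TensorProduct.map (twist (deg 𝒲) i) (mulι 𝒲 w)) ?_ t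
    apply tensor_homogeneous_ext (𝒲 := deg 𝒲)
    intro j a ha b
    have h1 := tmul_one_mul_coe_tmul (R := 𝕂) (deg 𝒲) (deg 𝒲) (ι 𝒲 w) ⟨a, ha⟩ b
    have h2 := tmul_coe_mul_coe_tmul (R := 𝕂) (deg 𝒲) (deg 𝒲) 1 ⟨ι 𝒲 w, ι_mem_deg hw⟩ ⟨a, ha⟩ b
    simp only [LinearMap.comp_apply, LinearEquiv.coe_coe, ← mul_def, add_mul,
      includeLeft_apply, includeRight_apply, LinearMap.add_apply, TensorProduct.map_tmul,
      LinearMap.id_apply, twist_apply ha, mulι_apply]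
    refine (congrArg (of 𝕂 (deg 𝒲) (deg 𝒲)).symm (congrArg₂ (· + ·) h1 h2)).trans ?_
    rw [map_add, one_mul]
    refine congrArg₂ (· + ·) rfl ?_
    rw [← TensorProduct.smul_tmul']
    exact units_smul_eq _ _
  have h := key (comul 𝒲 x)
  rw [← h, comul]
  simp only [LinearMap.comp_apply, AlgHom.toLinearMap_apply, map_mul, LinearEquiv.coe_coe,
    LinearEquiv.apply_symm_apply]
  congr 2
  rw [comulAlgHom, lift_ι]
  rfl

end

end GSym

/-! ### Counit, coassociativity and graded cocommutativity. -/

theorem tensor3_homogeneous_ext {𝕂 : Type*} [Field 𝕂] {W : Type*} [AddCommGroup W] [Module 𝕂 W]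
    {𝒲 : ℤ → Submodule 𝕂 W} [DirectSum.Decomposition 𝒲]
    {M : Type*} [AddCommGroup M] [Module 𝕂 M] {N : Type*} [AddCommGroup N] [Module 𝕂 N]
    {A B : W ⊗[𝕂] (W ⊗[𝕂] M) →ₗ[𝕂] N}
    (h : ∀ i j, ∀ v ∈ 𝒲 i, ∀ w ∈ 𝒲 j, ∀ m, A (v ⊗ₜ (w ⊗ₜ m)) = B (v ⊗ₜ (w ⊗ₜ m))) : A = B := by
  apply tensor_homogeneous_ext (𝒲 := 𝒲)
  intro i v hv t
  refine LinearMap.congr_fun (f := A ∘ₗ TensorProduct.mk 𝕂 W _ v)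
    (g := B ∘ₗ TensorProduct.mk 𝕂 W _ v) ?_ t
  apply tensor_homogeneous_ext (𝒲 := 𝒲)
  intro j w hw m
  exact h i j v hv w hw m

namespace GSym

open TensorProduct (map mk assoc)

variable {𝕂 : Type*} [Field 𝕂] {W : Type*} [AddCommGroup W] [Module 𝕂 W]
  {M : Type*} [AddCommGroup M] [Module 𝕂 M] {N : Type*} [AddCommGroup N] [Module 𝕂 N]
  {𝒲 : ℤ → Submodule 𝕂 W}

theorem counit_comp_mulι (w : W) : (counit 𝒲).toLinearMap ∘ₗ mulι 𝒲 w = 0 := by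
  ext x
  simp [mulι_apply]

variable [DirectSum.Decomposition 𝒲]

theorem comul_comp_mulι {i : ℤ} {w : W} (hw : w ∈ 𝒲 i) :
    comul 𝒲 ∘ₗ mulι 𝒲 w =
      (map (mulι 𝒲 w) LinearMap.id + map (twist (deg 𝒲) i) (mulι 𝒲 w)) ∘ₗ comul 𝒲 :=
  LinearMap.ext fun x => comul_mul hw x

theorem twist_comp_mulι {i : ℤ} {w : W} (hw : w ∈ 𝒲 i) (k : ℤ) :
    twist (deg 𝒲) k ∘ₗ mulι 𝒲 w = (-1 : 𝕂) ^ (k * i) • (mulι 𝒲 w ∘ₗ twist (deg 𝒲) k) :=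
  (isOfDegree_mulι hw).twist_comp

theorem twist_comm (k l : ℤ) : twist (deg 𝒲) k ∘ₗ twist (deg 𝒲) l =
    twist (deg 𝒲) l ∘ₗ twist (deg 𝒲) k := by
  rw [twist_comp_twist, twist_comp_twist, add_comm]

theorem comul_comp_twist (k : ℤ) : comul 𝒲 ∘ₗ twist (deg 𝒲) k =
    map (twist (deg 𝒲) k) (twist (deg 𝒲) k) ∘ₗ comul 𝒲 := by
  apply word_ext
  · simp only [LinearMap.comp_apply, twist_one, comul_one, TensorProduct.map_tmul]
  · intro i w hw x hx
    simp only [LinearMap.comp_apply] at hx ⊢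
    rw [twist_mul hw, map_smul, comul_mul hw, comul_mul hw, hx, map_add]
    simp only [TensorProduct.map_map, twist_comp_mulι hw, LinearMap.id_comp,
      LinearMap.comp_id, TensorProduct.map_smul_left,
      TensorProduct.map_smul_right, LinearMap.smul_apply, smul_add, twist_comm k i]

theorem counit_comp_twist (k : ℤ) :
    (counit 𝒲).toLinearMap ∘ₗ twist (deg 𝒲) k = (counit 𝒲).toLinearMap := by
  apply word_ext
  · rw [LinearMap.comp_apply, twist_one]
  · intro i w hw x _
    rw [LinearMap.comp_apply, twist_mul hw]
    simp

theorem counit_left (x : GSym 𝒲) :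
    map (counit 𝒲).toLinearMap LinearMap.id (comul 𝒲 x) = 1 ⊗ₜ x := by
  refine LinearMap.congr_fun (f := map (counit 𝒲).toLinearMap LinearMap.id ∘ₗ comul 𝒲)
    (g := mk 𝕂 𝕂 (GSym 𝒲) 1) ?_ x
  apply word_ext
  · simp [comul_one]
  · intro i w hw x hx
    simp only [LinearMap.comp_apply] at hx ⊢
    rw [comul_mul hw, map_add]
    simp only [TensorProduct.map_map, counit_comp_mulι, counit_comp_twist, LinearMap.id_comp,
      TensorProduct.map_zero_left, LinearMap.zero_apply, zero_add]
    rw [← LinearMap.id_comp (counit 𝒲).toLinearMap, ← LinearMap.comp_id (mulι 𝒲 w),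
      ← TensorProduct.map_map, hx]
    simp [mulι_apply]

theorem counit_right (x : GSym 𝒲) :
    map LinearMap.id (counit 𝒲).toLinearMap (comul 𝒲 x) = x ⊗ₜ 1 := by
  refine LinearMap.congr_fun (f := map LinearMap.id (counit 𝒲).toLinearMap ∘ₗ comul 𝒲)
    (g := (mk 𝕂 (GSym 𝒲) 𝕂).flip 1) ?_ x
  apply word_ext
  · simp [comul_one]
  · intro i w hw x hx
    simp only [LinearMap.comp_apply] at hx ⊢
    rw [comul_mul hw, map_add]
    simp only [TensorProduct.map_map, counit_comp_mulι, LinearMap.id_comp,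
      TensorProduct.map_zero_right, LinearMap.zero_apply, add_zero, LinearMap.comp_id]
    rw [← LinearMap.id_comp (counit 𝒲).toLinearMap, ← LinearMap.comp_id (mulι 𝒲 w),
      ← TensorProduct.map_map, hx]
    simp [mulι_apply]

/-- The action of a homogeneous `w` of degree `i` on the threefold tensor power, by multiplication
with `w ⊗ 1 ⊗ 1 + 1 ⊗ w ⊗ 1 + 1 ⊗ 1 ⊗ w`. -/
def mulι₃ (𝒲 : ℤ → Submodule 𝕂 W) [DirectSum.Decomposition 𝒲] (i : ℤ) (w : W) :
    GSym 𝒲 ⊗[𝕂] (GSym 𝒲 ⊗[𝕂] GSym 𝒲) →ₗ[𝕂] GSym 𝒲 ⊗[𝕂] (GSym 𝒲 ⊗[𝕂] GSym 𝒲) :=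
  map (mulι 𝒲 w) LinearMap.id + map (twist (deg 𝒲) i)
    (map (mulι 𝒲 w) LinearMap.id + map (twist (deg 𝒲) i) (mulι 𝒲 w))

/-- The iterated coproduct. -/
def comul₃ (𝒲 : ℤ → Submodule 𝕂 W) [DirectSum.Decomposition 𝒲] :
    GSym 𝒲 →ₗ[𝕂] GSym 𝒲 ⊗[𝕂] (GSym 𝒲 ⊗[𝕂] GSym 𝒲) :=
  map LinearMap.id (comul 𝒲) ∘ₗ comul 𝒲

/-- Together with the value at `1` this determines `comul₃`, so a symmetry of the iterated coproduct
only has to be checked against `mulι₃`. -/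
theorem comul₃_mul {i : ℤ} {w : W} (hw : w ∈ 𝒲 i) (x : GSym 𝒲) :
    comul₃ 𝒲 (ι 𝒲 w * x) = mulι₃ 𝒲 i w (comul₃ 𝒲 x) := by
  rw [comul₃, LinearMap.comp_apply, LinearMap.comp_apply, comul_mul hw, map_add, mulι₃,
    LinearMap.add_apply]
  simp only [TensorProduct.map_map, LinearMap.id_comp, LinearMap.comp_id, comul_comp_mulι hw]

theorem comul_coassoc :
    (assoc 𝕂 _ _ _).toLinearMap ∘ₗ map (comul 𝒲) LinearMap.id ∘ₗ comul 𝒲 = comul₃ 𝒲 := by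
  apply word_ext
  · simp [comul₃, comul_one]
  · intro i w hw x hx
    rw [comul₃_mul hw, ← hx]
    have h : ∀ (f g h : GSym 𝒲 →ₗ[𝕂] GSym 𝒲) (t : (GSym 𝒲 ⊗[𝕂] GSym 𝒲) ⊗[𝕂] GSym 𝒲),
        assoc 𝕂 _ _ _ (map (map f g) h t) = map f (map g h) (assoc 𝕂 _ _ _ t) :=
      fun f g h t => LinearMap.congr_fun (TensorProduct.map_map_comp_assoc_eq f g h).symm t
    have h1 : map (comul 𝒲 ∘ₗ mulι 𝒲 w) LinearMap.id =
        (map (map (mulι 𝒲 w) LinearMap.id) LinearMap.id + map (map (twist (deg 𝒲) i) (mulι 𝒲 w))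
          LinearMap.id) ∘ₗ map (comul 𝒲) (LinearMap.id (R := 𝕂) (M := GSym 𝒲)) := by
      rw [← TensorProduct.map_add_left, ← TensorProduct.map_comp, LinearMap.id_comp,
        comul_comp_mulι hw]
    have h2 : map (comul 𝒲 ∘ₗ twist (deg 𝒲) i) (mulι 𝒲 w) =
        map (map (twist (deg 𝒲) i) (twist (deg 𝒲) i)) (mulι 𝒲 w) ∘ₗ
          map (comul 𝒲) LinearMap.id := by
      rw [← TensorProduct.map_comp, comul_comp_twist, LinearMap.comp_id]
    simp only [LinearMap.comp_apply, LinearEquiv.coe_coe] at hx ⊢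
    rw [comul_mul hw, map_add, TensorProduct.map_map, TensorProduct.map_map, LinearMap.id_comp,
      LinearMap.id_comp, h1, h2]
    simp only [LinearMap.comp_apply, LinearMap.add_apply, map_add, h, mulι₃,
      TensorProduct.map_add_right, TensorProduct.map_id, add_assoc]

/-- The operator `a ⊗ (b ⊗ c) ↦ (-1)^(deg a * deg b) b ⊗ (a ⊗ c)`. -/
def braid (𝒲 : ℤ → Submodule 𝕂 W) [DirectSum.Decomposition 𝒲] :
    GSym 𝒲 ⊗[𝕂] (GSym 𝒲 ⊗[𝕂] GSym 𝒲) →ₗ[𝕂] GSym 𝒲 ⊗[𝕂] (GSym 𝒲 ⊗[𝕂] GSym 𝒲) :=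
  TensorProduct.lift (gradedLift
    (N := GSym 𝒲 ⊗[𝕂] GSym 𝒲 →ₗ[𝕂] GSym 𝒲 ⊗[𝕂] (GSym 𝒲 ⊗[𝕂] GSym 𝒲))
    (deg 𝒲) fun i => (mk 𝕂 _ _).compr₂
    (map (twist (deg 𝒲) i) LinearMap.id ∘ₗ
      (TensorProduct.leftComm 𝕂 (GSym 𝒲) (GSym 𝒲) (GSym 𝒲)).toLinearMap))

theorem braid_tmul {i : ℤ} {a : GSym 𝒲} (ha : a ∈ deg 𝒲 i) (b c : GSym 𝒲) :
    braid 𝒲 (a ⊗ₜ (b ⊗ₜ c)) = twist (deg 𝒲) i b ⊗ₜ (a ⊗ₜ c) := by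
  rw [braid, TensorProduct.lift.tmul, gradedLift_apply _ ha]
  rfl

/-- The element `w ⊗ 1 ⊗ 1 + 1 ⊗ w ⊗ 1 + 1 ⊗ 1 ⊗ w` is invariant under the signed exchange of the
first two factors. -/
theorem braid_comp_mulι₃ {i : ℤ} {w : W} (hw : w ∈ 𝒲 i) :
    braid 𝒲 ∘ₗ mulι₃ 𝒲 i w = mulι₃ 𝒲 i w ∘ₗ braid 𝒲 := by
  apply tensor3_homogeneous_ext (𝒲 := deg 𝒲)
  intro j k a ha b hb c
  have hwa : ι 𝒲 w * a ∈ deg 𝒲 (i + j) := SetLike.GradedMul.mul_mem (ι_mem_deg hw) ha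
  have hwb : ι 𝒲 w * b ∈ deg 𝒲 (i + k) := SetLike.GradedMul.mul_mem (ι_mem_deg hw) hb
  simp only [mulι₃, LinearMap.comp_apply, LinearMap.add_apply, TensorProduct.map_tmul, mulι_apply,
    LinearMap.id_apply, twist_apply ha, twist_apply hb, TensorProduct.tmul_add,
    ← TensorProduct.smul_tmul', TensorProduct.tmul_smul, map_add, map_smul, braid_tmul ha,
    braid_tmul hwa, twist_apply hwb, smul_smul, sgn_mul, smul_add]
  -- The sign of `w` passing `a` occurs twice, once in the twist and once in the braiding, and
  -- cancels.
  rw [sgn_congr (m := i * j + j * (i + k)) (n := j * k) ⟨i * j, by ring⟩,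
    show (i + j) * k = j * k + i * k by ring,
    show i * k + i * j + j * k = j * k + (i * j + i * k) by ring]
  abel

end GSym

/-! ### Convolution products and their compatibility with the coproduct. -/

namespace GSym

open TensorProduct (map mk assoc)

variable {𝕂 : Type*} [Field 𝕂] {W : Type*} [AddCommGroup W] [Module 𝕂 W]
  {W' : Type*} [AddCommGroup W'] [Module 𝕂 W']
  {M : Type*} [AddCommGroup M] [Module 𝕂 M] {N : Type*} [AddCommGroup N] [Module 𝕂 N]
  {𝒲 : ℤ → Submodule 𝕂 W} [DirectSum.Decomposition 𝒲]
  {𝒲' : ℤ → Submodule 𝕂 W'} [DirectSum.Decomposition 𝒲']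

/-- Graded cocommutativity, in the form needed to let the middle factor of the iterated coproduct
come first. -/
theorem braid_comp_comul₃ : braid 𝒲 ∘ₗ comul₃ 𝒲 = comul₃ 𝒲 := by
  apply word_ext
  · have h : comul₃ 𝒲 1 = 1 ⊗ₜ (1 ⊗ₜ 1) := by simp [comul₃, comul_one]
    rw [LinearMap.comp_apply, h, braid_tmul (one_mem_deg (𝒲 := 𝒲)), twist_one]
  · intro i w hw x hx
    rw [LinearMap.comp_apply] at hx ⊢
    rw [comul₃_mul hw, ← LinearMap.comp_apply, braid_comp_mulι₃ hw, LinearMap.comp_apply, hx]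

/-- The map `(a ⊗ (b ⊗ c)) ↦ (a ⊗ 1 + 1 ⊗ a) (b ⊗ c)`. -/
def primMul (𝒲 : ℤ → Submodule 𝕂 W) [DirectSum.Decomposition 𝒲] :
    GSym 𝒲 ⊗[𝕂] (GSym 𝒲 ⊗[𝕂] GSym 𝒲) →ₗ[𝕂] GSym 𝒲 ⊗[𝕂] GSym 𝒲 :=
  map (LinearMap.mul' 𝕂 _) LinearMap.id ∘ₗ (assoc 𝕂 _ _ _).symm.toLinearMap +
    map LinearMap.id (LinearMap.mul' 𝕂 _) ∘ₗ braid 𝒲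

theorem comul_comp_mul : comul 𝒲 ∘ₗ LinearMap.mul' 𝕂 _ ∘ₗ map (ι 𝒲) LinearMap.id =
    primMul 𝒲 ∘ₗ map (ι 𝒲) (comul 𝒲) := by
  apply tensor_homogeneous_ext (𝒲 := 𝒲)
  intro i w hw x
  simp only [LinearMap.comp_apply, TensorProduct.map_tmul, LinearMap.id_apply,
    LinearMap.mul'_apply]
  rw [comul_mul hw]
  refine LinearMap.congr_fun (f := map (mulι 𝒲 w) LinearMap.id +
    map (twist (deg 𝒲) i) (mulι 𝒲 w)) (g := primMul 𝒲 ∘ₗ mk 𝕂 _ _ (ι 𝒲 w)) ?_ (comul 𝒲 x)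
  ext a b
  simp [primMul, braid_tmul (ι_mem_deg hw), mulι_apply]

/-- The convolution product of `g` and `G`. -/
def conv (g : GSym 𝒲 →ₗ[𝕂] W') (G : GSym 𝒲 →ₗ[𝕂] GSym 𝒲') : GSym 𝒲 →ₗ[𝕂] GSym 𝒲' :=
  LinearMap.mul' 𝕂 (GSym 𝒲') ∘ₗ map (ι 𝒲' ∘ₗ g) G ∘ₗ comul 𝒲

/-- The summand `a ⊗ 1` is handled by coassociativity. The summand `1 ⊗ a` needs cocommutativity to
bring `g` next to the second copy of `G`; passing `g` of degree `k` across a factor produces the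
twist. -/
theorem primMul_comul₃ {k : ℤ} {g : GSym 𝒲 →ₗ[𝕂] W'} {G : GSym 𝒲 →ₗ[𝕂] GSym 𝒲'}
    (hg : IsOfDegree (deg 𝒲) 𝒲' k g) (hG : IsOfDegree (deg 𝒲) (deg 𝒲') 0 G) :
    primMul 𝒲' ∘ₗ map (ι 𝒲' ∘ₗ g) (map G G) ∘ₗ comul₃ 𝒲 =
      (map (conv g G) G + map (G ∘ₗ twist (deg 𝒲) k) (conv g G)) ∘ₗ comul 𝒲 := by
  rw [primMul, LinearMap.add_comp, LinearMap.add_comp]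
  congr 1
  · rw [← comul_coassoc]
    ext x
    simp only [LinearMap.comp_apply, LinearEquiv.coe_coe, ← TensorProduct.map_map_assoc_symm,
      LinearEquiv.symm_apply_apply, TensorProduct.map_map, LinearMap.comp_id, LinearMap.id_comp]
    rfl
  · have h : braid 𝒲' ∘ₗ map (ι 𝒲' ∘ₗ g) (map G G) =
        map (G ∘ₗ twist (deg 𝒲) k) (map (ι 𝒲' ∘ₗ g) G) ∘ₗ braid 𝒲 := by
      apply tensor3_homogeneous_ext (𝒲 := deg 𝒲)
      intro i j a ha b hb c
      have hGb := hG j b hb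
      rw [add_zero] at hGb
      simp only [LinearMap.comp_apply, TensorProduct.map_tmul, braid_tmul ha,
        braid_tmul (ι_mem_deg (hg i a ha)), twist_apply hGb, twist_apply hb, map_smul,
        ← TensorProduct.smul_tmul', smul_smul, sgn_mul]
      rw [show (i + k) * j = i * j + k * j by ring]
    calc _ = map LinearMap.id (LinearMap.mul' 𝕂 _) ∘ₗ
          (braid 𝒲' ∘ₗ map (ι 𝒲' ∘ₗ g) (map G G)) ∘ₗ comul₃ 𝒲 := rfl
      _ = map LinearMap.id (LinearMap.mul' 𝕂 _) ∘ₗ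
          map (G ∘ₗ twist (deg 𝒲) k) (map (ι 𝒲' ∘ₗ g) G) ∘ₗ braid 𝒲 ∘ₗ comul₃ 𝒲 := by
        rw [h]; rfl
      _ = _ := by
        rw [braid_comp_comul₃, comul₃]
        ext x
        simp only [LinearMap.comp_apply, TensorProduct.map_map, LinearMap.comp_id,
          LinearMap.id_comp]
        rfl

/-- No compatibility of `G` with coproducts is assumed, so this applies to a `G` whose failure to be
a coalgebra morphism is being measured. -/
theorem comul_comp_conv' (g : GSym 𝒲 →ₗ[𝕂] W') (G : GSym 𝒲 →ₗ[𝕂] GSym 𝒲') :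
    comul 𝒲' ∘ₗ conv g G = primMul 𝒲' ∘ₗ map (ι 𝒲' ∘ₗ g) (comul 𝒲' ∘ₗ G) ∘ₗ comul 𝒲 := by
  have h : comul 𝒲' ∘ₗ conv g G = (comul 𝒲' ∘ₗ LinearMap.mul' 𝕂 _ ∘ₗ map (ι 𝒲') LinearMap.id) ∘ₗ
      map g G ∘ₗ comul 𝒲 := by
    ext x
    simp only [conv, LinearMap.comp_apply, TensorProduct.map_map, LinearMap.id_comp]
  rw [h, comul_comp_mul]
  ext x
  simp only [LinearMap.comp_apply, TensorProduct.map_map]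

/-- Convolving with a map into the primitive elements turns a coalgebra morphism `G` into a
coderivation along `G`. -/
theorem comul_comp_conv {k : ℤ} {g : GSym 𝒲 →ₗ[𝕂] W'} {G : GSym 𝒲 →ₗ[𝕂] GSym 𝒲'}
    (hg : IsOfDegree (deg 𝒲) 𝒲' k g) (hG : IsOfDegree (deg 𝒲) (deg 𝒲') 0 G)
    (h : comul 𝒲' ∘ₗ G = map G G ∘ₗ comul 𝒲) :
    comul 𝒲' ∘ₗ conv g G =
      (map (conv g G) G + map (G ∘ₗ twist (deg 𝒲) k) (conv g G)) ∘ₗ comul 𝒲 := by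
  rw [← primMul_comul₃ hg hG, comul_comp_conv', h, comul₃]
  ext x
  simp only [LinearMap.comp_apply, TensorProduct.map_map, LinearMap.comp_id]

/-- A dual form of the fact that `Δ` maps `filt n` into the sum of the `filt a ⊗ filt b` with `a + b
≤ n`. Stating it for arbitrary `A` and `B` makes the induction work: a new letter is absorbed by
precomposing `A` or `B`. -/
theorem map_comul_eq_zero {n : ℕ} {x : GSym 𝒲} (hx : x ∈ filt 𝒲 n) (A : GSym 𝒲 →ₗ[𝕂] M)
    (B : GSym 𝒲 →ₗ[𝕂] N)
    (h : ∀ a b, a + b ≤ n → (∀ y ∈ filt 𝒲 a, A y = 0) ∨ ∀ y ∈ filt 𝒲 b, B y = 0) :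
    map A B (comul 𝒲 x) = 0 := by
  induction hx using Submodule.span_induction with
  | mem x hx =>
    obtain ⟨m, hm, k, hx⟩ := hx
    replace h : ∀ a b, a + b ≤ m → (∀ y ∈ filt 𝒲 a, A y = 0) ∨ ∀ y ∈ filt 𝒲 b, B y = 0 :=
      fun a b hab => h a b (hab.trans hm)
    clear hm
    induction hx generalizing A B with
    | one =>
      rw [comul_one, TensorProduct.map_tmul]
      rcases h 0 0 le_rfl with h | h
      · rw [h 1 IsWord.one.mem_filt, TensorProduct.zero_tmul]
      · rw [h 1 IsWord.one.mem_filt, TensorProduct.tmul_zero]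
    | @mul m i k w x hw hx ih =>
      rw [comul_mul hw, map_add, TensorProduct.map_map, TensorProduct.map_map, ih, ih, add_zero]
      · intro a b hab
        rcases h a (b + 1) (by omega) with h | h
        · exact Or.inl fun y hy => h _ (twist_mem_filt hy)
        · exact Or.inr fun y hy => h _ (ι_mul_mem_filt hw hy)
      · intro a b hab
        rcases h (a + 1) b (by omega) with h | h
        · exact Or.inl fun y hy => h _ (ι_mul_mem_filt hw hy)
        · exact Or.inr fun y hy => h _ hy
  | zero => simp
  | add x y _ _ hx hy => rw [map_add, map_add, hx, hy, add_zero]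
  | smul a x _ hx => rw [map_smul, map_smul, hx, smul_zero]

theorem isOfDegree_twist (k : ℤ) : IsOfDegree (deg 𝒲) (deg 𝒲) 0 (twist (deg 𝒲) k) := by
  intro i x hx
  rw [twist_apply hx, add_zero]
  exact Submodule.smul_mem _ _ hx

/-- Homogeneity of `Δ`, again tested against arbitrary `A` and `B` so that each letter can be
absorbed into one of them, shifting its degree. -/
theorem isOfDegree_mul_map_comul {a b : ℤ} {A B : GSym 𝒲 →ₗ[𝕂] GSym 𝒲'}
    (hA : IsOfDegree (deg 𝒲) (deg 𝒲') a A) (hB : IsOfDegree (deg 𝒲) (deg 𝒲') b B) :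
    IsOfDegree (deg 𝒲) (deg 𝒲') (a + b) (LinearMap.mul' 𝕂 _ ∘ₗ map A B ∘ₗ comul 𝒲) := by
  intro k x hx
  rw [deg_eq_span] at hx
  induction hx using Submodule.span_induction with
  | mem x hx =>
    obtain ⟨n, hx⟩ := hx
    induction hx generalizing a b A B with
    | one =>
      simp only [LinearMap.comp_apply, comul_one, TensorProduct.map_tmul, LinearMap.mul'_apply]
      have h1 := hA 0 1 one_mem_deg
      have h2 := hB 0 1 one_mem_deg
      rw [zero_add] at h1 h2 ⊢
      exact SetLike.GradedMul.mul_mem h1 h2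
    | @mul m i k w x hw hx ih =>
      simp only [LinearMap.comp_apply, comul_mul hw, map_add, TensorProduct.map_map] at ih ⊢
      rw [LinearMap.comp_id]
      have h1 := ih (hA.comp (isOfDegree_mulι hw) rfl) hB
      have h2 := ih (hA.comp (isOfDegree_twist i) (zero_add a)) (hB.comp (isOfDegree_mulι hw) rfl)
      rw [show i + k + (a + b) = k + (i + a + b) by ring]
      refine add_mem h1 ?_
      rw [show k + (i + a + b) = k + (a + (i + b)) by ring]
      exact h2
  | zero => rw [map_zero]; exact zero_mem _
  | add x y _ _ hx hy => rw [map_add]; exact add_mem hx hy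
  | smul a x _ hx => rw [map_smul]; exact Submodule.smul_mem _ _ hx

end GSym

/-! ### Passage to the reduced coalgebra: corestrictions and coderivations. -/

namespace GSym

open TensorProduct (map mk assoc)

section

variable {𝕂 : Type*} [Field 𝕂] {W : Type*} [AddCommGroup W] [Module 𝕂 W]
  {𝒲 : ℤ → Submodule 𝕂 W}

theorem toReduced_one : toReduced 𝒲 1 = 0 := by
  apply Subtype.ext
  simp

theorem toReduced_coe (x : Reduced 𝒲) : toReduced 𝒲 (x : GSym 𝒲) = x := by
  apply Subtype.ext
  have hx : counit 𝒲 (x : GSym 𝒲) = 0 := x.2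
  simp [hx]

theorem toReduced_comp_subtype : toReduced 𝒲 ∘ₗ (Reduced 𝒲).subtype = LinearMap.id :=
  LinearMap.ext toReduced_coe

theorem counit_of_isWord {n : ℕ} {k : ℤ} {x : GSym 𝒲} (hx : IsWord 𝒲 (n + 1) k x) :
    counit 𝒲 x = 0 := by
  cases hx
  simp

theorem coe_toReduced_of_isWord {n : ℕ} {k : ℤ} {x : GSym 𝒲} (hx : IsWord 𝒲 (n + 1) k x) :
    (toReduced 𝒲 x : GSym 𝒲) = x := by
  simp [counit_of_isWord hx]

theorem IsWord.eq_one {k : ℤ} {x : GSym 𝒲} (h : IsWord 𝒲 0 k x) : x = 1 := by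
  cases h
  rfl

theorem toReduced_of_mem_filt_zero {x : GSym 𝒲} (hx : x ∈ filt 𝒲 0) : toReduced 𝒲 x = 0 := by
  induction hx using Submodule.span_induction with
  | mem x h =>
    obtain ⟨m, hm, k, h⟩ := h
    obtain rfl : m = 0 := by omega
    rw [h.eq_one, toReduced_one]
  | zero => rw [map_zero]
  | add x y _ _ hx hy => rw [map_add, hx, hy, add_zero]
  | smul a x _ hx => rw [map_smul, hx, smul_zero]

theorem toReduced_mul_of_right (x y : GSym 𝒲) (h : counit 𝒲 x = 0) :
    (toReduced 𝒲 (x * y) : GSym 𝒲) = x * y := by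
  simp [h]

theorem pr_toReduced_mul (w : W) (x : GSym 𝒲) :
    pr 𝒲 (toReduced 𝒲 (ι 𝒲 w * x)) = counit 𝒲 x • w := by
  change (linAct 𝒲 (toReduced 𝒲 (ι 𝒲 w * x) : GSym 𝒲) (1, 0)).2 = _
  rw [toReduced_mul_of_right _ _ (counit_ι _ _), map_mul, Module.End.mul_apply, linAct_ι,
    fst_linAct, mul_one]

theorem pr_mem {k : ℤ} {x : GSym 𝒲} (hx : x ∈ deg 𝒲 k) : pr 𝒲 (toReduced 𝒲 x) ∈ 𝒲 k := by
  rw [deg_eq_span] at hx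
  induction hx using Submodule.span_induction with
  | mem x hx =>
    obtain ⟨n, hx⟩ := hx
    cases hx with
    | one => rw [toReduced_one, map_zero]; exact zero_mem _
    | @mul n i k w x hw hx =>
      rw [pr_toReduced_mul]
      cases n with
      | zero =>
        cases hx
        rw [map_one, one_smul, add_zero]
        exact hw
      | succ n => rw [counit_of_isWord hx, zero_smul]; exact zero_mem _
  | zero => rw [map_zero, map_zero]; exact zero_mem _
  | add x y _ _ hx hy => rw [map_add, map_add]; exact add_mem hx hy
  | smul a x _ hx => rw [map_smul, map_smul]; exact Submodule.smul_mem _ _ hx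

theorem isOfDegree_pr : IsOfDegree (redDeg 𝒲) 𝒲 0 (pr 𝒲) := by
  intro k x hx
  rw [add_zero, ← toReduced_coe x]
  exact pr_mem hx

theorem isOfDegree_subtype : IsOfDegree (redDeg 𝒲) (deg 𝒲) 0 (Reduced 𝒲).subtype := by
  intro k x hx
  rw [add_zero]
  exact hx

theorem isOfDegree_toReduced : IsOfDegree (deg 𝒲) (redDeg 𝒲) 0 (toReduced 𝒲) := by
  intro k x hx
  rw [add_zero]
  rw [deg_eq_span] at hx
  induction hx using Submodule.span_induction with
  | mem x hx =>
    obtain ⟨n, hx⟩ := hx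
    cases n with
    | zero => rw [hx.eq_one, toReduced_one]; exact zero_mem _
    | succ n =>
      change (toReduced 𝒲 x : GSym 𝒲) ∈ deg 𝒲 k
      rw [coe_toReduced_of_isWord hx]
      exact hx.mem_deg
  | zero => rw [map_zero]; exact zero_mem _
  | add x y _ _ hx hy => rw [map_add]; exact add_mem hx hy
  | smul a x _ hx => rw [map_smul]; exact Submodule.smul_mem _ _ hx

theorem isOfDegree_ι : IsOfDegree 𝒲 (deg 𝒲) 0 (ι 𝒲) := by
  intro k w hw
  rw [add_zero]
  exact ι_mem_deg hw

theorem isOfDegree_incl : IsOfDegree 𝒲 (redDeg 𝒲) 0 (incl 𝒲) := by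
  intro k w hw
  rw [add_zero]
  exact ι_mem_deg hw

variable {W' : Type*} [AddCommGroup W'] [Module 𝕂 W'] {𝒲' : ℤ → Submodule 𝕂 W'}

/-- The unital extension of a linear map between reduced symmetric coalgebras. -/
def unital (G : Reduced 𝒲 →ₗ[𝕂] Reduced 𝒲') : GSym 𝒲 →ₗ[𝕂] GSym 𝒲' :=
  (Reduced 𝒲').subtype ∘ₗ G ∘ₗ toReduced 𝒲 +
    Algebra.linearMap 𝕂 (GSym 𝒲') ∘ₗ (counit 𝒲).toLinearMap

theorem unital_id : unital (LinearMap.id : Reduced 𝒲 →ₗ[𝕂] Reduced 𝒲) = LinearMap.id := by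
  ext x
  simp [unital]

theorem unital_one (G : Reduced 𝒲 →ₗ[𝕂] Reduced 𝒲') : unital G 1 = 1 := by
  simp [unital, toReduced_one]

theorem toReduced_comp_unital (G : Reduced 𝒲 →ₗ[𝕂] Reduced 𝒲') :
    toReduced 𝒲' ∘ₗ unital G = G ∘ₗ toReduced 𝒲 := by
  ext x
  simp only [unital, LinearMap.comp_apply, LinearMap.add_apply, map_add, Submodule.subtype_apply,
    toReduced_coe, Algebra.linearMap_apply, Algebra.algebraMap_eq_smul_one, map_smul,
    toReduced_one, smul_zero, add_zero]

end

variable {𝕂 : Type*} [Field 𝕂] {W : Type*} [AddCommGroup W] [Module 𝕂 W]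
  {W' : Type*} [AddCommGroup W'] [Module 𝕂 W']
  {M : Type*} [AddCommGroup M] [Module 𝕂 M] {N : Type*} [AddCommGroup N] [Module 𝕂 N]
  {𝒲 : ℤ → Submodule 𝕂 W} [DirectSum.Decomposition 𝒲] {𝒲' : ℤ → Submodule 𝕂 W'}

theorem redComul_comp_toReduced : redComul 𝒲 ∘ₗ toReduced 𝒲 =
    map (toReduced 𝒲) (toReduced 𝒲) ∘ₗ comul 𝒲 := by
  ext x
  simp only [redComul, LinearMap.comp_apply, Submodule.subtype_apply, coe_toReduced, map_sub]
  rw [Algebra.algebraMap_eq_smul_one, map_smul, map_smul, comul_one, TensorProduct.map_tmul,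
    toReduced_one, TensorProduct.zero_tmul, smul_zero]
  exact sub_zero (map (toReduced 𝒲) (toReduced 𝒲) (comul 𝒲 x))

theorem redComul_incl (w : W) : redComul 𝒲 (incl 𝒲 w) = 0 := by
  refine LinearMap.congr_fun (f := redComul 𝒲 ∘ₗ incl 𝒲) (g := 0) ?_ w
  apply homogeneous_ext (N := Reduced 𝒲 ⊗[𝕂] Reduced 𝒲) (𝒲 := 𝒲)
  intro i w hw
  simp only [redComul, LinearMap.comp_apply, Submodule.subtype_apply, coe_incl]
  rw [← mul_one (ι 𝒲 w), comul_mul hw, comul_one]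
  simp [twist_one, toReduced_one]

/-- The convolution product of `g` and `G` with respect to the reduced coproduct. -/
def redConv (g : Reduced 𝒲 →ₗ[𝕂] W') (G : Reduced 𝒲 →ₗ[𝕂] Reduced 𝒲') :
    Reduced 𝒲 →ₗ[𝕂] Reduced 𝒲' :=
  toReduced 𝒲' ∘ₗ LinearMap.mul' 𝕂 (GSym 𝒲') ∘ₗ
    map (Reduced 𝒲').subtype (Reduced 𝒲').subtype ∘ₗ map (incl 𝒲' ∘ₗ g) G ∘ₗ redComul 𝒲

/-- Values of `redConv` are sums of products of two elements without constant term, which have no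
part in `⊙^1`. -/
theorem pr_comp_redConv (g : Reduced 𝒲 →ₗ[𝕂] W') (G : Reduced 𝒲 →ₗ[𝕂] Reduced 𝒲') :
    pr 𝒲' ∘ₗ redConv g G = 0 := by
  have h : pr 𝒲' ∘ₗ toReduced 𝒲' ∘ₗ LinearMap.mul' 𝕂 (GSym 𝒲') ∘ₗ
    map (Reduced 𝒲').subtype (Reduced 𝒲').subtype = 0 := by
    ext x y
    have hx : counit 𝒲' (x : GSym 𝒲') = 0 := x.2
    have hxy : (x : GSym 𝒲') * y ∈ Reduced 𝒲' := by
      change counit 𝒲' (x * y : GSym 𝒲') = 0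
      rw [map_mul, hx, zero_mul]
    simpa [toReduced_coe ⟨_, hxy⟩] using (congrArg (pr 𝒲') (toReduced_coe ⟨_, hxy⟩)).trans
      (pr_mul x y hxy)
  rw [redConv, ← LinearMap.zero_comp (map (incl 𝒲' ∘ₗ g) G ∘ₗ redComul 𝒲), ← h]
  rfl

/-- The term `x ⊗ 1` of the full coproduct contributes `g` itself; the rest is the reduced
convolution. -/
theorem conv_unital (g : Reduced 𝒲 →ₗ[𝕂] W') (G : Reduced 𝒲 →ₗ[𝕂] Reduced 𝒲') :
    conv (g ∘ₗ toReduced 𝒲) (unital G) =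
      (Reduced 𝒲').subtype ∘ₗ (incl 𝒲' ∘ₗ g + redConv g G) ∘ₗ toReduced 𝒲 := by
  have h1 : LinearMap.mul' 𝕂 (GSym 𝒲') ∘ₗ map (ι 𝒲' ∘ₗ g ∘ₗ toReduced 𝒲)
      (Algebra.linearMap 𝕂 (GSym 𝒲') ∘ₗ (counit 𝒲).toLinearMap) ∘ₗ comul 𝒲 =
      (Reduced 𝒲').subtype ∘ₗ incl 𝒲' ∘ₗ g ∘ₗ toReduced 𝒲 := by
    ext x
    rw [← LinearMap.comp_id (ι 𝒲' ∘ₗ g ∘ₗ toReduced 𝒲), LinearMap.comp_apply,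
      LinearMap.comp_apply, ← TensorProduct.map_map, counit_right]
    simp
  have h2 : LinearMap.mul' 𝕂 (GSym 𝒲') ∘ₗ map (ι 𝒲' ∘ₗ g ∘ₗ toReduced 𝒲)
      ((Reduced 𝒲').subtype ∘ₗ G ∘ₗ toReduced 𝒲) ∘ₗ comul 𝒲 =
      (Reduced 𝒲').subtype ∘ₗ redConv g G ∘ₗ toReduced 𝒲 := by
    have h3 : (Reduced 𝒲').subtype ∘ₗ toReduced 𝒲' ∘ₗ LinearMap.mul' 𝕂 (GSym 𝒲') ∘ₗ
        map (Reduced 𝒲').subtype (Reduced 𝒲').subtype =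
        LinearMap.mul' 𝕂 (GSym 𝒲') ∘ₗ map (Reduced 𝒲').subtype (Reduced 𝒲').subtype := by
      ext x y
      exact toReduced_mul_of_right _ _ x.2
    calc _ = (LinearMap.mul' 𝕂 (GSym 𝒲') ∘ₗ map (Reduced 𝒲').subtype (Reduced 𝒲').subtype) ∘ₗ
          map (incl 𝒲' ∘ₗ g) G ∘ₗ map (toReduced 𝒲) (toReduced 𝒲) ∘ₗ comul 𝒲 := by
          ext x
          simp only [LinearMap.comp_apply, TensorProduct.map_map]
          rfl
      _ = _ := by
          rw [← h3, ← redComul_comp_toReduced]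
          rfl
  rw [LinearMap.add_comp, LinearMap.comp_add, ← h2, conv, unital, TensorProduct.map_add_right,
    LinearMap.add_comp, LinearMap.comp_add, add_comm]
  exact congrArg₂ _ h1 rfl

theorem coderivation_eq_conv (q : Reduced 𝒲 →ₗ[𝕂] W) : coderivation q =
    toReduced 𝒲 ∘ₗ conv (q ∘ₗ toReduced 𝒲) LinearMap.id ∘ₗ (Reduced 𝒲).subtype := rfl

theorem conv_id (q : Reduced 𝒲 →ₗ[𝕂] W) : conv (q ∘ₗ toReduced 𝒲) LinearMap.id =
    (Reduced 𝒲).subtype ∘ₗ (incl 𝒲 ∘ₗ q + redConv q LinearMap.id) ∘ₗ toReduced 𝒲 := by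
  rw [← conv_unital, unital_id]

theorem coderivation_eq (q : Reduced 𝒲 →ₗ[𝕂] W) :
    coderivation q = incl 𝒲 ∘ₗ q + redConv q LinearMap.id := by
  rw [coderivation_eq_conv, conv_id]
  ext x
  simp only [LinearMap.comp_apply, Submodule.subtype_apply, toReduced_coe]

theorem conv_id' (q : Reduced 𝒲 →ₗ[𝕂] W) : conv (q ∘ₗ toReduced 𝒲) LinearMap.id =
    (Reduced 𝒲).subtype ∘ₗ coderivation q ∘ₗ toReduced 𝒲 := by
  rw [conv_id, coderivation_eq]

theorem pr_comp_coderivation (q : Reduced 𝒲 →ₗ[𝕂] W) : pr 𝒲 ∘ₗ coderivation q = q := by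
  rw [coderivation_eq, LinearMap.comp_add, pr_comp_redConv, add_zero]
  ext x
  exact pr_incl _

theorem isOfDegree_redConv [DirectSum.Decomposition 𝒲'] {a b : ℤ}
    {g : Reduced 𝒲 →ₗ[𝕂] W'} {G : Reduced 𝒲 →ₗ[𝕂] Reduced 𝒲'}
    (hg : IsOfDegree (redDeg 𝒲) 𝒲' a g) (hG : IsOfDegree (redDeg 𝒲) (redDeg 𝒲') b G) :
    IsOfDegree (redDeg 𝒲) (redDeg 𝒲') (a + b) (redConv g G) := by
  have h : redConv g G = toReduced 𝒲' ∘ₗ (LinearMap.mul' 𝕂 _ ∘ₗ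
      map (ι 𝒲' ∘ₗ g ∘ₗ toReduced 𝒲) ((Reduced 𝒲').subtype ∘ₗ G ∘ₗ toReduced 𝒲) ∘ₗ comul 𝒲) ∘ₗ
        (Reduced 𝒲).subtype := by
    ext x
    simp only [redConv, redComul, LinearMap.comp_apply, TensorProduct.map_map]
    rfl
  rw [h]
  refine isOfDegree_toReduced.comp ((isOfDegree_mul_map_comul (a := a) (b := b) ?_ ?_).comp
    isOfDegree_subtype (zero_add _)) (add_zero _)
  · exact isOfDegree_ι.comp (hg.comp isOfDegree_toReduced (zero_add _)) (add_zero _)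
  · exact isOfDegree_subtype.comp (hG.comp isOfDegree_toReduced (zero_add _)) (add_zero _)

theorem isOfDegree_coderivation {k : ℤ} {q : Reduced 𝒲 →ₗ[𝕂] W}
    (hq : IsOfDegree (redDeg 𝒲) 𝒲 k q) :
    IsOfDegree (redDeg 𝒲) (redDeg 𝒲) k (coderivation q) := by
  rw [coderivation_eq]
  refine (isOfDegree_incl.comp hq (add_zero _)).add ?_
  have h := isOfDegree_redConv hq IsOfDegree.id
  rwa [add_zero] at h

variable (𝒲) in
/-- The operator multiplying the component of degree `i` by `(-1) ^ (k * i)`. -/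
def redTwist (k : ℤ) : Reduced 𝒲 →ₗ[𝕂] Reduced 𝒲 :=
  toReduced 𝒲 ∘ₗ twist (deg 𝒲) k ∘ₗ (Reduced 𝒲).subtype

theorem toReduced_comp_twist (k : ℤ) :
    toReduced 𝒲 ∘ₗ twist (deg 𝒲) k = redTwist 𝒲 k ∘ₗ toReduced 𝒲 := by
  ext x
  simp [redTwist, map_sub, Algebra.algebraMap_eq_smul_one, twist_one, toReduced_one]

theorem coe_redTwist (k : ℤ) (x : Reduced 𝒲) :
    (redTwist 𝒲 k x : GSym 𝒲) = twist (deg 𝒲) k (x : GSym 𝒲) := by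
  have h := LinearMap.congr_fun (counit_comp_twist (𝒲 := 𝒲) k) (x : GSym 𝒲)
  have hx : counit 𝒲 (x : GSym 𝒲) = 0 := x.2
  simp only [LinearMap.comp_apply, AlgHom.toLinearMap_apply, hx] at h
  simp [redTwist, h]

theorem IsOfDegree.redTwist_comp [DirectSum.Decomposition 𝒲'] {k d : ℤ}
    {F : Reduced 𝒲 →ₗ[𝕂] Reduced 𝒲'} (hF : IsOfDegree (redDeg 𝒲) (redDeg 𝒲') d F) :
    redTwist 𝒲' k ∘ₗ F = (-1 : 𝕂) ^ (k * d) • (F ∘ₗ redTwist 𝒲 k) := by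
  have h := ((isOfDegree_subtype.comp hF (add_zero d)).comp isOfDegree_toReduced
    (zero_add d)).twist_comp (k := k)
  ext x
  have h1 := LinearMap.congr_fun h (x : GSym 𝒲)
  simp only [LinearMap.comp_apply, toReduced_coe, Submodule.subtype_apply,
    LinearMap.smul_apply] at h1
  simp only [LinearMap.comp_apply, coe_redTwist, h1, LinearMap.smul_apply, Submodule.coe_smul]
  rfl

theorem redTwist_comp_redTwist_of_even {k : ℤ} (l : ℤ) (h : Even (k + l)) :
    redTwist 𝒲 k ∘ₗ redTwist 𝒲 l = LinearMap.id := by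
  ext x
  simp only [LinearMap.comp_apply, coe_redTwist]
  rw [← LinearMap.comp_apply (twist _ _), twist_comp_twist, twist_of_even h]
  rfl

/-- The case `G = id` of `comul_comp_conv`, transported to the reduced coalgebra; `redTwist` carries
the sign of moving a degree `k` operator past the left factor. -/
theorem redComul_comp_coderivation {k : ℤ} {q : Reduced 𝒲 →ₗ[𝕂] W}
    (hq : IsOfDegree (redDeg 𝒲) 𝒲 k q) :
    redComul 𝒲 ∘ₗ coderivation q =
      (map (coderivation q) LinearMap.id + map (redTwist 𝒲 k) (coderivation q)) ∘ₗ
        redComul 𝒲 := by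
  have h1 : toReduced 𝒲 ∘ₗ conv (q ∘ₗ toReduced 𝒲) LinearMap.id =
      coderivation q ∘ₗ toReduced 𝒲 := by
    rw [conv_id', ← LinearMap.comp_assoc, toReduced_comp_subtype, LinearMap.id_comp]
  have h2 := comul_comp_conv (hq.comp isOfDegree_toReduced (zero_add k)) IsOfDegree.id
    (by simp : comul 𝒲 ∘ₗ LinearMap.id = map LinearMap.id LinearMap.id ∘ₗ comul 𝒲)
  calc _ = (redComul 𝒲 ∘ₗ toReduced 𝒲) ∘ₗ conv (q ∘ₗ toReduced 𝒲) LinearMap.id ∘ₗ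
        (Reduced 𝒲).subtype := rfl
    _ = map (toReduced 𝒲) (toReduced 𝒲) ∘ₗ
        (comul 𝒲 ∘ₗ conv (q ∘ₗ toReduced 𝒲) LinearMap.id) ∘ₗ (Reduced 𝒲).subtype := by
      rw [redComul_comp_toReduced]
      rfl
    _ = _ := ?_
  rw [h2]
  ext x
  simp only [LinearMap.comp_apply, LinearMap.add_apply, map_add, TensorProduct.map_map, redComul,
    LinearMap.id_comp, LinearMap.comp_id, toReduced_comp_twist, h1]

end GSym

/-! ### The Euler coderivation, primitive elements and the vanishing principle. -/

namespace GSym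

open TensorProduct (map mk assoc)

variable {𝕂 : Type*} [Field 𝕂] {W : Type*} [AddCommGroup W] [Module 𝕂 W]
  {W' : Type*} [AddCommGroup W'] [Module 𝕂 W']
  {M : Type*} [AddCommGroup M] [Module 𝕂 M] {N : Type*} [AddCommGroup N] [Module 𝕂 N]
  {𝒲 : ℤ → Submodule 𝕂 W} [DirectSum.Decomposition 𝒲]
  {𝒲' : ℤ → Submodule 𝕂 W'} [DirectSum.Decomposition 𝒲']

variable (𝒲) in
/-- The Euler coderivation, multiplying `⊙^n W` by `n`. -/
def euler : Reduced 𝒲 →ₗ[𝕂] Reduced 𝒲 := coderivation (pr 𝒲)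

/-- The Leibniz rule `E (w x) = E(w) x + w E(x)` with `E(w) = w`. -/
theorem conv_pr_mul {i : ℤ} {w : W} (hw : w ∈ 𝒲 i) (x : GSym 𝒲) :
    conv (pr 𝒲 ∘ₗ toReduced 𝒲) LinearMap.id (ι 𝒲 w * x) =
      ι 𝒲 w * x + ι 𝒲 w * conv (pr 𝒲 ∘ₗ toReduced 𝒲) LinearMap.id x := by
  have h1 : (ι 𝒲 ∘ₗ pr 𝒲 ∘ₗ toReduced 𝒲) ∘ₗ mulι 𝒲 w =
      LinearMap.toSpanSingleton 𝕂 _ (ι 𝒲 w) ∘ₗ (counit 𝒲).toLinearMap := by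
    ext y
    simp only [LinearMap.comp_apply, mulι_apply, pr_toReduced_mul, map_smul,
      LinearMap.toSpanSingleton_apply, AlgHom.toLinearMap_apply]
  have h2 : LinearMap.mul' 𝕂 (GSym 𝒲) ∘ₗ
      map ((ι 𝒲 ∘ₗ pr 𝒲 ∘ₗ toReduced 𝒲) ∘ₗ twist (deg 𝒲) i) (mulι 𝒲 w) =
      mulι 𝒲 w ∘ₗ LinearMap.mul' 𝕂 (GSym 𝒲) ∘ₗ
        map (ι 𝒲 ∘ₗ pr 𝒲 ∘ₗ toReduced 𝒲) LinearMap.id := by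
    apply tensor_homogeneous_ext (𝒲 := deg 𝒲)
    intro j a ha b
    have h := ι_mul_ι (pr_mem ha) hw
    rw [units_smul_eq (𝕂 := 𝕂)] at h
    simp only [LinearMap.comp_apply, TensorProduct.map_tmul, LinearMap.mul'_apply, mulι_apply,
      LinearMap.id_apply, twist_apply ha, map_smul]
    -- The twist sign cancels the sign from commuting `pr a` past `w`, since `pr` preserves degree.
    rw [← mul_assoc, smul_mul_assoc, h, smul_smul, sgn_mul, ← mul_assoc,
      sgn_congr (n := 0) ⟨i * j, by ring⟩, zpow_zero, one_smul]
  simp only [conv, LinearMap.comp_apply, comul_mul hw, map_add, TensorProduct.map_map,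
    LinearMap.id_comp]
  congr 1
  · rw [h1, ← LinearMap.comp_id LinearMap.id, ← TensorProduct.map_map, counit_left]
    simp
  · exact LinearMap.congr_fun h2 (comul 𝒲 x)

theorem conv_pr_of_isWord {n : ℕ} {k : ℤ} {x : GSym 𝒲} (hx : IsWord 𝒲 n k x) :
    conv (pr 𝒲 ∘ₗ toReduced 𝒲) LinearMap.id x = (n : 𝕂) • x := by
  induction hx with
  | one => simp [conv, comul_one, toReduced_one]
  | @mul n i k w x hw hx ih =>
    rw [conv_pr_mul hw, ih, Nat.cast_succ, add_smul, one_smul, mul_smul_comm, add_comm]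

theorem coe_euler (x : Reduced 𝒲) :
    (euler 𝒲 x : GSym 𝒲) = conv (pr 𝒲 ∘ₗ toReduced 𝒲) LinearMap.id (x : GSym 𝒲) := by
  rw [conv_id', LinearMap.comp_apply, LinearMap.comp_apply, toReduced_coe]
  rfl

theorem euler_toReduced {n : ℕ} {k : ℤ} {x : GSym 𝒲} (hx : IsWord 𝒲 n k x) :
    euler 𝒲 (toReduced 𝒲 x) = (n : 𝕂) • toReduced 𝒲 x := by
  have h := congrArg (toReduced 𝒲) (conv_pr_of_isWord hx)
  rwa [conv_id', LinearMap.comp_apply, Submodule.subtype_apply, toReduced_coe, map_smul] at h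

theorem euler_incl (w : W) : euler 𝒲 (incl 𝒲 w) = incl 𝒲 w := by
  rw [euler, coderivation_eq, LinearMap.add_apply, redConv]
  simp only [LinearMap.comp_apply, redComul_incl, map_zero, add_zero, pr_incl]

theorem isOfDegree_euler : IsOfDegree (redDeg 𝒲) (redDeg 𝒲) 0 (euler 𝒲) :=
  isOfDegree_coderivation isOfDegree_pr

section CharZero

variable [CharZero 𝕂]

/-- No direct sum decomposition by length is needed. Nonempty words are eigenvectors of `E` with
eigenvalues that are nonzero in characteristic `0`, so a reduced element killed by `E` lies both in
the `0`-eigenspace and in the sum of the others; these are independent. -/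
theorem euler_injective : Function.Injective (euler 𝒲) := by
  rw [← LinearMap.ker_eq_bot, LinearMap.ker_eq_bot']
  intro x hx
  set E : Module.End 𝕂 (GSym 𝒲) := conv (pr 𝒲 ∘ₗ toReduced 𝒲) LinearMap.id with hE
  have h0 : (x : GSym 𝒲) ∈ E.eigenspace 0 := by
    rw [Module.End.mem_eigenspace_iff, hE, ← coe_euler, hx, zero_smul, Submodule.coe_zero]
  have h1 : ∀ y : GSym 𝒲, (toReduced 𝒲 y : GSym 𝒲) ∈ ⨆ μ ≠ (0 : 𝕂), E.eigenspace μ := by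
    intro y
    have hy : y ∈ Submodule.span 𝕂 {x | ∃ n k, IsWord 𝒲 n k x} := by rw [span_words]; trivial
    induction hy using Submodule.span_induction with
    | mem y h =>
      obtain ⟨n, k, h⟩ := h
      cases n with
      | zero => rw [h.eq_one, toReduced_one]; exact zero_mem _
      | succ n =>
        rw [coe_toReduced_of_isWord h]
        refine Submodule.mem_iSup_of_mem ((n + 1 : ℕ) : 𝕂) (Submodule.mem_iSup_of_mem
          (Nat.cast_ne_zero.2 n.succ_ne_zero) ?_)
        exact Module.End.mem_eigenspace_iff.2 (conv_pr_of_isWord h)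
    | zero => rw [map_zero]; exact zero_mem _
    | add x y _ _ hx hy => rw [map_add]; exact add_mem hx hy
    | smul a x _ hx => rw [map_smul]; exact Submodule.smul_mem _ _ hx
  have h2 := h1 x
  rw [toReduced_coe] at h2
  exact Subtype.ext (Submodule.disjoint_def.1 (E.eigenspaces_iSupIndep 0) _ h0 h2)

theorem euler_surjective : Function.Surjective (euler 𝒲) := by
  intro x
  have h : ∀ y : GSym 𝒲, toReduced 𝒲 y ∈ LinearMap.range (euler 𝒲) := by
    intro y
    have hy : y ∈ Submodule.span 𝕂 {x | ∃ n k, IsWord 𝒲 n k x} := by rw [span_words]; trivial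
    induction hy using Submodule.span_induction with
    | mem y h =>
      obtain ⟨n, k, h⟩ := h
      cases n with
      | zero => rw [h.eq_one, toReduced_one]; exact zero_mem _
      | succ n =>
        refine ⟨((n + 1 : ℕ) : 𝕂)⁻¹ • toReduced 𝒲 y, ?_⟩
        rw [map_smul, euler_toReduced h,
          inv_smul_smul₀ (Nat.cast_ne_zero.2 n.succ_ne_zero)]
    | zero => rw [map_zero]; exact zero_mem _
    | add x y _ _ hx hy => rw [map_add]; exact add_mem hx hy
    | smul a x _ hx => rw [map_smul]; exact Submodule.smul_mem _ _ hx
  rw [← toReduced_coe x]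
  exact h x

variable (𝒲) in
/-- The inverse of the Euler coderivation, dividing `⊙^n W` by `n`. -/
def eulerInv : Reduced 𝒲 →ₗ[𝕂] Reduced 𝒲 :=
  (LinearEquiv.ofBijective (euler 𝒲) ⟨euler_injective, euler_surjective⟩).symm.toLinearMap

theorem euler_eulerInv (x : Reduced 𝒲) : euler 𝒲 (eulerInv 𝒲 x) = x :=
  (LinearEquiv.ofBijective (euler 𝒲) ⟨euler_injective, euler_surjective⟩).apply_symm_apply x

theorem eulerInv_euler (x : Reduced 𝒲) : eulerInv 𝒲 (euler 𝒲 x) = x :=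
  (LinearEquiv.ofBijective (euler 𝒲) ⟨euler_injective, euler_surjective⟩).symm_apply_apply x

theorem eulerInv_toReduced {n : ℕ} {k : ℤ} {x : GSym 𝒲} (hx : IsWord 𝒲 n k x) :
    eulerInv 𝒲 (toReduced 𝒲 x) = (n : 𝕂)⁻¹ • toReduced 𝒲 x := by
  cases n with
  | zero => rw [hx.eq_one, toReduced_one, map_zero, smul_zero]
  | succ n =>
    apply euler_injective
    rw [euler_eulerInv, map_smul, euler_toReduced hx,
      inv_smul_smul₀ (Nat.cast_ne_zero.2 n.succ_ne_zero)]

theorem isOfDegree_eulerInv : IsOfDegree (redDeg 𝒲) (redDeg 𝒲) 0 (eulerInv 𝒲) := by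
  intro k x hx
  have h : ∀ y ∈ deg 𝒲 k, eulerInv 𝒲 (toReduced 𝒲 y) ∈ redDeg 𝒲 k := by
    intro y hy
    rw [deg_eq_span] at hy
    induction hy using Submodule.span_induction with
    | mem y h =>
      obtain ⟨n, h⟩ := h
      rw [eulerInv_toReduced h]
      have h' := isOfDegree_toReduced _ _ h.mem_deg
      rw [add_zero] at h'
      exact Submodule.smul_mem _ _ h'
    | zero => rw [map_zero, map_zero]; exact zero_mem _
    | add x y _ _ hx hy => rw [map_add, map_add]; exact add_mem hx hy
    | smul a x _ hx => rw [map_smul, map_smul]; exact Submodule.smul_mem _ _ hx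
  rw [add_zero, ← toReduced_coe x]
  exact h _ hx

/-- The primitive elements of the reduced symmetric coalgebra are the elements of `⊙^1 W`. -/
theorem eq_incl_of_redComul_eq_zero {x : Reduced 𝒲} (hx : redComul 𝒲 x = 0) :
    x = incl 𝒲 (pr 𝒲 x) := by
  apply euler_injective
  -- On a primitive `x` the convolution term vanishes, leaving `E x = incl (pr x)`, which is also `E
  -- (incl (pr x))`.
  rw [euler_incl, euler, coderivation_eq, LinearMap.add_apply, redConv]
  simp only [LinearMap.comp_apply, hx, map_zero, add_zero]

end CharZero

/-- In the reduced coproduct both factors are nonempty, so for a word of length at most `n + 1` each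
has length at most `n`. This is what drives every induction on length. -/
theorem map_redComul_eq_zero {n : ℕ} {x : GSym 𝒲} (hx : x ∈ filt 𝒲 (n + 1))
    {A : Reduced 𝒲 →ₗ[𝕂] M} {B : Reduced 𝒲 →ₗ[𝕂] N}
    (h : (∀ y ∈ filt 𝒲 n, A (toReduced 𝒲 y) = 0) ∨ ∀ y ∈ filt 𝒲 n, B (toReduced 𝒲 y) = 0) :
    map A B (redComul 𝒲 (toReduced 𝒲 x)) = 0 := by
  have h1 : map A B (redComul 𝒲 (toReduced 𝒲 x)) =
      map (A ∘ₗ toReduced 𝒲) (B ∘ₗ toReduced 𝒲) (comul 𝒲 x) := by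
    rw [← TensorProduct.map_map]
    exact congrArg _ (LinearMap.congr_fun redComul_comp_toReduced x)
  rw [h1]
  apply map_comul_eq_zero hx
  intro a b hab
  rcases Nat.eq_zero_or_pos a with rfl | ha
  · refine Or.inl fun y hy => ?_
    rw [LinearMap.comp_apply, toReduced_of_mem_filt_zero hy, map_zero]
  rcases Nat.eq_zero_or_pos b with rfl | hb
  · refine Or.inr fun y hy => ?_
    rw [LinearMap.comp_apply, toReduced_of_mem_filt_zero hy, map_zero]
  rcases h with h | h
  · exact Or.inl fun y hy => h y (filt_mono (by omega) hy)
  · exact Or.inr fun y hy => h y (filt_mono (by omega) hy)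

/-- A linear map which is a coderivation along coalgebra maps vanishes as soon as its linear
component depends only on its non-linear components. -/
theorem eq_zero_of_redComul [CharZero 𝕂] {D A B : Reduced 𝒲 →ₗ[𝕂] Reduced 𝒲'}
    {T : Reduced 𝒲' →ₗ[𝕂] W'} (hD : redComul 𝒲' ∘ₗ D = (map D A + map B D) ∘ₗ redComul 𝒲)
    (hpr : pr 𝒲' ∘ₗ D = T ∘ₗ D) (hT : T ∘ₗ incl 𝒲' = 0) : D = 0 := by
  have h : ∀ n, ∀ x ∈ filt 𝒲 n, D (toReduced 𝒲 x) = 0 := by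
    intro n
    induction n with
    | zero =>
      intro x hx
      rw [toReduced_of_mem_filt_zero hx, map_zero]
    | succ n ih =>
      intro x hx
      have h1 : redComul 𝒲' (D (toReduced 𝒲 x)) = 0 := by
        refine (LinearMap.congr_fun hD _).trans ?_
        rw [LinearMap.comp_apply, LinearMap.add_apply, map_redComul_eq_zero hx (Or.inl ih),
          map_redComul_eq_zero hx (Or.inr ih), add_zero]
      have h2 := eq_incl_of_redComul_eq_zero h1
      -- Since `D x` is primitive, it lies in `⊙^1`, where `T` vanishes.
      have h3 : pr 𝒲' (D (toReduced 𝒲 x)) = 0 := by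
        refine (LinearMap.congr_fun hpr _).trans ?_
        rw [LinearMap.comp_apply, h2]
        exact LinearMap.congr_fun hT _
      rw [h2, h3, map_zero]
  ext1 x
  obtain ⟨n, hn⟩ := exists_mem_filt (x : GSym 𝒲)
  rw [← toReduced_coe x]
  exact h n _ hn

end GSym

/-! ### Construction of coalgebra morphisms by recursion on word length. -/

section TensorProduct

variable {R : Type*} [CommRing R] {M M' N N' : Type*} [AddCommGroup M] [Module R M]
  [AddCommGroup M'] [Module R M'] [AddCommGroup N] [Module R N] [AddCommGroup N'] [Module R N']

theorem tensorMap_sub_left (f f' : M →ₗ[R] M') (g : N →ₗ[R] N') :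
    TensorProduct.map (f - f') g = TensorProduct.map f g - TensorProduct.map f' g := by
  rw [eq_sub_iff_add_eq, ← TensorProduct.map_add_left, sub_add_cancel]

theorem tensorMap_sub_right (f : M →ₗ[R] M') (g g' : N →ₗ[R] N') :
    TensorProduct.map f (g - g') = TensorProduct.map f g - TensorProduct.map f g' := by
  rw [eq_sub_iff_add_eq, ← TensorProduct.map_add_right, sub_add_cancel]

theorem tensorMap_sub_tensorMap (f f' : M →ₗ[R] M') (g g' : N →ₗ[R] N') :
    TensorProduct.map f g - TensorProduct.map f' g' =
      TensorProduct.map (f - f') g + TensorProduct.map f' (g - g') := by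
  rw [tensorMap_sub_left, tensorMap_sub_right, sub_add_sub_cancel]

theorem tensorMap_apply_congr {f f' : M →ₗ[R] M'} {g g' : N →ₗ[R] N'} {t : M ⊗[R] N}
    (hf : TensorProduct.map (f - f') g t = 0) (hg : TensorProduct.map f' (g - g') t = 0) :
    TensorProduct.map f g t = TensorProduct.map f' g' t := by
  rw [← sub_eq_zero, ← LinearMap.sub_apply, tensorMap_sub_tensorMap, LinearMap.add_apply, hf, hg,
    add_zero]

end TensorProduct

/-- A contraction for an exhaustive filtration has a fixed point, which is locally an iterate. -/
theorem exists_fixedPoint {𝕂 : Type*} [Field 𝕂] {M : Type*} [AddCommGroup M] [Module 𝕂 M]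
    {N : Type*} [AddCommGroup N] [Module 𝕂 N] (Fil : ℕ → Submodule 𝕂 M) (hmono : Monotone Fil)
    (h0 : Fil 0 = ⊥) (hex : ∀ x, ∃ n, x ∈ Fil n) (Ψ : (M →ₗ[𝕂] N) → (M →ₗ[𝕂] N))
    (hΨ : ∀ F G n, (∀ x ∈ Fil n, F x = G x) → ∀ x ∈ Fil (n + 1), Ψ F x = Ψ G x) :
    ∃ F, Ψ F = F ∧ ∀ x, ∃ n, F x = (Ψ^[n] 0) x := by
  have h1 : ∀ n F G, ∀ x ∈ Fil n, (Ψ^[n] F) x = (Ψ^[n] G) x := by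
    intro n
    induction n with
    | zero =>
      intro F G x hx
      rw [h0, Submodule.mem_bot] at hx
      rw [hx, map_zero, map_zero]
    | succ n ih =>
      intro F G x hx
      rw [Function.iterate_succ_apply', Function.iterate_succ_apply']
      exact hΨ _ _ n (ih F G) x hx
  have h2 : ∀ m n x, n ≤ m → x ∈ Fil n → (Ψ^[m] 0) x = (Ψ^[n] 0) x := by
    intro m n x hnm hx
    obtain ⟨k, rfl⟩ := Nat.exists_eq_add_of_le hnm
    rw [Function.iterate_add_apply]
    exact h1 n _ _ x hx
  choose d hd using hex
  -- Any admissible index computes the same value; this independence of the choice `d` makes the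
  -- pointwise limit linear.
  have h3 : ∀ n x, x ∈ Fil n → (Ψ^[d x] 0) x = (Ψ^[n] 0) x := fun n x hx => by
    rw [← h2 (max n (d x)) n x (le_max_left _ _) hx,
      ← h2 (max n (d x)) (d x) x (le_max_right _ _) (hd x)]
  let F : M →ₗ[𝕂] N :=
    { toFun := fun x => (Ψ^[d x] 0) x
      map_add' := fun x y => by
        have hx := hmono (le_max_left (d x) (d y)) (hd x)
        have hy := hmono (le_max_right (d x) (d y)) (hd y)
        rw [h3 _ x hx, h3 _ y hy, h3 _ (x + y) (add_mem hx hy), map_add]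
      map_smul' := fun a x => by
        rw [h3 _ (a • x) (Submodule.smul_mem _ a (hd x)), map_smul, RingHom.id_apply] }
  have hF : ∀ n, ∀ x ∈ Fil n, F x = (Ψ^[n] 0) x := fun n x hx => h3 n x hx
  refine ⟨F, ?_, fun x => ⟨d x, rfl⟩⟩
  ext x
  have hx := hmono (Nat.le_succ (d x)) (hd x)
  rw [hΨ _ _ _ (hF (d x)) x hx, hF _ x hx, Function.iterate_succ_apply']

namespace GSym

open TensorProduct (map mk assoc)

variable {𝕂 : Type*} [Field 𝕂] {W : Type*} [AddCommGroup W] [Module 𝕂 W]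
  {W' : Type*} [AddCommGroup W'] [Module 𝕂 W']
  {𝒲 : ℤ → Submodule 𝕂 W}
  {𝒲' : ℤ → Submodule 𝕂 W'}

variable (𝒲) in
/-- The filtration of the reduced symmetric coalgebra by the subspaces `⨁_{1 ≤ m ≤ n} ⊙^m W`. -/
def redFilt (n : ℕ) : Submodule 𝕂 (Reduced 𝒲) := (filt 𝒲 n).map (toReduced 𝒲)

theorem redFilt_mono : Monotone (redFilt 𝒲) := fun _ _ h => Submodule.map_mono (filt_mono h)

theorem redFilt_zero : redFilt 𝒲 0 = ⊥ := by
  rw [eq_bot_iff]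
  rintro _ ⟨x, hx, rfl⟩
  exact toReduced_of_mem_filt_zero hx

theorem map_mem_redFilt {T : Reduced 𝒲 →ₗ[𝕂] Reduced 𝒲} (c : ℕ → 𝕂)
    (hT : ∀ n k x, IsWord 𝒲 n k x → T (toReduced 𝒲 x) = c n • toReduced 𝒲 x) {n : ℕ}
    {x : Reduced 𝒲} (hx : x ∈ redFilt 𝒲 n) : T x ∈ redFilt 𝒲 n := by
  obtain ⟨x, hx, rfl⟩ := hx
  induction hx using Submodule.span_induction with
  | mem x h =>
    obtain ⟨m, hm, k, h⟩ := h
    rw [hT m k x h]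
    exact Submodule.smul_mem _ _ ⟨x, filt_mono hm h.mem_filt, rfl⟩
  | zero => rw [map_zero, map_zero]; exact zero_mem _
  | add x y _ _ hx hy => rw [map_add, map_add]; exact add_mem hx hy
  | smul a x _ hx => rw [map_smul, map_smul]; exact Submodule.smul_mem _ _ hx

theorem isOfDegree_unital {F : Reduced 𝒲 →ₗ[𝕂] Reduced 𝒲'}
    (hF : IsOfDegree (redDeg 𝒲) (redDeg 𝒲') 0 F) : IsOfDegree (deg 𝒲) (deg 𝒲') 0 (unital F) := by
  refine (isOfDegree_subtype.comp (hF.comp isOfDegree_toReduced (zero_add _)) (zero_add _)).add ?_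
  intro k x hx
  rw [deg_eq_span] at hx
  induction hx using Submodule.span_induction with
  | mem x hx =>
    obtain ⟨n, hx⟩ := hx
    rw [LinearMap.comp_apply, AlgHom.toLinearMap_apply]
    cases n with
    | zero =>
      cases hx
      rw [map_one, Algebra.linearMap_apply, map_one]
      exact one_mem_deg
    | succ n => rw [counit_of_isWord hx, map_zero]; exact zero_mem _
  | zero => rw [map_zero]; exact zero_mem _
  | add x y _ _ hx hy => rw [map_add]; exact add_mem hx hy
  | smul a x _ hx => rw [map_smul]; exact Submodule.smul_mem _ _ hx

variable [DirectSum.Decomposition 𝒲] [DirectSum.Decomposition 𝒲']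

theorem exists_mem_redFilt (x : Reduced 𝒲) : ∃ n, x ∈ redFilt 𝒲 n := by
  obtain ⟨n, hn⟩ := exists_mem_filt (x : GSym 𝒲)
  exact ⟨n, x, hn, toReduced_coe x⟩

theorem redConv_congr {g g' : Reduced 𝒲 →ₗ[𝕂] W'} {G G' : Reduced 𝒲 →ₗ[𝕂] Reduced 𝒲'} {n : ℕ}
    (hg : ∀ x ∈ redFilt 𝒲 n, g x = g' x) (hG : ∀ x ∈ redFilt 𝒲 n, G x = G' x) {x : Reduced 𝒲}
    (hx : x ∈ redFilt 𝒲 (n + 1)) : redConv g G x = redConv g' G' x := by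
  obtain ⟨x, hx, rfl⟩ := hx
  have h1 : map (incl 𝒲' ∘ₗ g - incl 𝒲' ∘ₗ g') G (redComul 𝒲 (toReduced 𝒲 x)) = 0 := by
    refine map_redComul_eq_zero hx (Or.inl fun y hy => ?_)
    rw [LinearMap.sub_apply, LinearMap.comp_apply, LinearMap.comp_apply, hg _ ⟨y, hy, rfl⟩,
      sub_self]
  have h2 : map (incl 𝒲' ∘ₗ g') (G - G') (redComul 𝒲 (toReduced 𝒲 x)) = 0 := by
    refine map_redComul_eq_zero hx (Or.inr fun y hy => ?_)
    rw [LinearMap.sub_apply, hG _ ⟨y, hy, rfl⟩, sub_self]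
  simp only [redConv, LinearMap.comp_apply]
  rw [tensorMap_apply_congr h1 h2]

/-- The hypothesis is the differential equation `F E = (f E) * F` of the convolution exponential.
Both `Δ F` and `(F ⊗ F) Δ` satisfy the same linear recursion deduced from it, with the same value at
`1`, so they agree. -/
theorem comul_comp_unital [CharZero 𝕂] {F : Reduced 𝒲 →ₗ[𝕂] Reduced 𝒲'} {f : Reduced 𝒲 →ₗ[𝕂] W'}
    (hF : IsOfDegree (redDeg 𝒲) (redDeg 𝒲') 0 F) (hf : IsOfDegree (redDeg 𝒲) 𝒲' 0 f)
    (h : F ∘ₗ euler 𝒲 = incl 𝒲' ∘ₗ f ∘ₗ euler 𝒲 + redConv (f ∘ₗ euler 𝒲) F) :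
    comul 𝒲' ∘ₗ unital F = map (unital F) (unital F) ∘ₗ comul 𝒲 := by
  set g : GSym 𝒲 →ₗ[𝕂] W' := (f ∘ₗ euler 𝒲) ∘ₗ toReduced 𝒲 with hg_def
  set E : GSym 𝒲 →ₗ[𝕂] GSym 𝒲 := conv (pr 𝒲 ∘ₗ toReduced 𝒲) LinearMap.id with hE_def
  have hg : IsOfDegree (deg 𝒲) 𝒲' 0 g :=
    (hf.comp isOfDegree_euler (zero_add _)).comp isOfDegree_toReduced (zero_add _)
  have hG := isOfDegree_unital hF
  have htw : twist (deg 𝒲) 0 = LinearMap.id := twist_of_even (by simp)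
  have hFE : unital F ∘ₗ E = conv g (unital F) := by
    rw [hg_def, conv_unital, ← h, hE_def, conv_id']
    ext x
    simp only [unital, LinearMap.comp_apply, LinearMap.add_apply, Submodule.subtype_apply,
      toReduced_coe]
    have h0 : counit 𝒲 (coderivation (pr 𝒲) (toReduced 𝒲 x) : GSym 𝒲) = 0 :=
      (coderivation (pr 𝒲) (toReduced 𝒲 x)).2
    rw [AlgHom.toLinearMap_apply, h0, map_zero, add_zero]
    rfl
  have h1 : comul 𝒲 ∘ₗ E = (map E LinearMap.id + map LinearMap.id E) ∘ₗ comul 𝒲 := by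
    have := comul_comp_conv (isOfDegree_pr.comp isOfDegree_toReduced (zero_add 0)) IsOfDegree.id
      (by simp : comul 𝒲 ∘ₗ LinearMap.id = map LinearMap.id LinearMap.id ∘ₗ comul 𝒲)
    rwa [htw, LinearMap.comp_id] at this
  set D := comul 𝒲' ∘ₗ unital F - map (unital F) (unital F) ∘ₗ comul 𝒲 with hD
  -- The defect `D` satisfies a homogeneous equation: `D E` is determined by `D` on shorter words,
  -- because `g` vanishes on constants.
  have h2 : D ∘ₗ E = primMul 𝒲' ∘ₗ map (ι 𝒲' ∘ₗ g) D ∘ₗ comul 𝒲 := by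
    have h3 : map (unital F) (unital F) ∘ₗ comul 𝒲 ∘ₗ E = primMul 𝒲' ∘ₗ
        map (ι 𝒲' ∘ₗ g) (map (unital F) (unital F) ∘ₗ comul 𝒲) ∘ₗ comul 𝒲 := by
      have h4 := primMul_comul₃ hg hG
      rw [htw, LinearMap.comp_id, ← hFE] at h4
      calc _ = (map (unital F ∘ₗ E) (unital F) + map (unital F) (unital F ∘ₗ E)) ∘ₗ comul 𝒲 := by
            rw [h1]
            ext x
            simp only [LinearMap.comp_apply, LinearMap.add_apply, map_add, TensorProduct.map_map,
              LinearMap.comp_id]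
        _ = _ := by
            rw [← h4, comul₃]
            ext x
            simp only [LinearMap.comp_apply, TensorProduct.map_map, LinearMap.comp_id]
    calc _ = comul 𝒲' ∘ₗ conv g (unital F) -
          map (unital F) (unital F) ∘ₗ comul 𝒲 ∘ₗ E := by
            rw [← hFE]
            rfl
      _ = primMul 𝒲' ∘ₗ (map (ι 𝒲' ∘ₗ g) (comul 𝒲' ∘ₗ unital F) -
          map (ι 𝒲' ∘ₗ g) (map (unital F) (unital F) ∘ₗ comul 𝒲)) ∘ₗ comul 𝒲 := by
            rw [h3, comul_comp_conv', LinearMap.sub_comp, LinearMap.comp_sub]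
      _ = _ := by
            rw [hD, tensorMap_sub_right]
  have h3 : ∀ n, ∀ x ∈ filt 𝒲 n, D x = 0 := by
    intro n
    induction n with
    | zero =>
      intro x hx
      induction hx using Submodule.span_induction with
      | mem x h =>
        obtain ⟨m, hm, k, h⟩ := h
        obtain rfl : m = 0 := by omega
        rw [h.eq_one, hD]
        simp [unital_one, comul_one]
      | zero => rw [map_zero]
      | add x y _ _ hx hy => rw [map_add, hx, hy, add_zero]
      | smul a x _ hx => rw [map_smul, hx, smul_zero]
    | succ n ih =>
      intro x hx
      induction hx using Submodule.span_induction with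
      | mem x h =>
        obtain ⟨m, hm, k, h⟩ := h
        rcases hm.lt_or_eq with hm | rfl
        · exact ih x (filt_mono (by omega) h.mem_filt)
        -- On a word of length `n + 1` the left side is `(n + 1) D x` and the right side vanishes by
        -- induction; characteristic `0` permits the division.
        · have h5 := LinearMap.congr_fun h2 x
          rw [LinearMap.comp_apply, hE_def, conv_pr_of_isWord h, map_smul, LinearMap.comp_apply,
            LinearMap.comp_apply, map_comul_eq_zero h.mem_filt, map_zero] at h5
          · exact (smul_eq_zero.1 h5).resolve_left (Nat.cast_ne_zero.2 n.succ_ne_zero)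
          · intro a b hab
            rcases Nat.eq_zero_or_pos a with rfl | ha
            · refine Or.inl fun y hy => ?_
              rw [LinearMap.comp_apply, hg_def, LinearMap.comp_apply,
                toReduced_of_mem_filt_zero hy, map_zero, map_zero]
            · exact Or.inr fun y hy => ih y (filt_mono (by omega) hy)
      | zero => rw [map_zero]
      | add x y _ _ hx hy => rw [map_add, hx, hy, add_zero]
      | smul a x _ hx => rw [map_smul, hx, smul_zero]
  rw [← sub_eq_zero, ← hD]
  exact ext_of_filt h3

theorem isCoalgebraHom_of_comul_comp_unital {F : Reduced 𝒲 →ₗ[𝕂] Reduced 𝒲'}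
    (h : comul 𝒲' ∘ₗ unital F = map (unital F) (unital F) ∘ₗ comul 𝒲) : IsCoalgebraHom F := by
  have h1 : F = toReduced 𝒲' ∘ₗ unital F ∘ₗ (Reduced 𝒲).subtype := by
    rw [← LinearMap.comp_assoc, toReduced_comp_unital, LinearMap.comp_assoc,
      toReduced_comp_subtype, LinearMap.comp_id]
  calc redComul 𝒲' ∘ₗ F = (redComul 𝒲' ∘ₗ toReduced 𝒲') ∘ₗ unital F ∘ₗ
        (Reduced 𝒲).subtype := congrArg (fun G => redComul 𝒲' ∘ₗ G) h1
    _ = map (toReduced 𝒲') (toReduced 𝒲') ∘ₗ (comul 𝒲' ∘ₗ unital F) ∘ₗ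
        (Reduced 𝒲).subtype := by
      rw [redComul_comp_toReduced]
      rfl
    _ = _ := by
      rw [h, redComul]
      ext x
      simp only [LinearMap.comp_apply, TensorProduct.map_map, toReduced_comp_unital]

section Lifting

variable [CharZero 𝕂]

/-- The non-linear part of the morphism of coalgebras with linear component `f` whose lower order
part is `F`. -/
def nonlinearPart (f : Reduced 𝒲 →ₗ[𝕂] W') (F : Reduced 𝒲 →ₗ[𝕂] Reduced 𝒲') :
    Reduced 𝒲 →ₗ[𝕂] Reduced 𝒲' :=
  redConv (f ∘ₗ euler 𝒲) F ∘ₗ eulerInv 𝒲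

theorem nonlinearPart_euler (f : Reduced 𝒲 →ₗ[𝕂] W') (F : Reduced 𝒲 →ₗ[𝕂] Reduced 𝒲')
    (x : Reduced 𝒲) : nonlinearPart f F (euler 𝒲 x) = redConv (f ∘ₗ euler 𝒲) F x := by
  rw [nonlinearPart, LinearMap.comp_apply, eulerInv_euler]

theorem pr_nonlinearPart (f : Reduced 𝒲 →ₗ[𝕂] W') (F : Reduced 𝒲 →ₗ[𝕂] Reduced 𝒲')
    (x : Reduced 𝒲) : pr 𝒲' (nonlinearPart f F x) = 0 :=
  LinearMap.congr_fun (pr_comp_redConv (f ∘ₗ euler 𝒲) F) (eulerInv 𝒲 x)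

theorem isOfDegree_nonlinearPart {f : Reduced 𝒲 →ₗ[𝕂] W'} {F : Reduced 𝒲 →ₗ[𝕂] Reduced 𝒲'}
    (hf : IsOfDegree (redDeg 𝒲) 𝒲' 0 f) (hF : IsOfDegree (redDeg 𝒲) (redDeg 𝒲') 0 F) :
    IsOfDegree (redDeg 𝒲) (redDeg 𝒲') 0 (nonlinearPart f F) :=
  (isOfDegree_redConv (hf.comp isOfDegree_euler (zero_add _)) hF).comp isOfDegree_eulerInv
    (by norm_num)

theorem nonlinearPart_congr {f f' : Reduced 𝒲 →ₗ[𝕂] W'} {F F' : Reduced 𝒲 →ₗ[𝕂] Reduced 𝒲'}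
    {n : ℕ} (hf : ∀ x ∈ redFilt 𝒲 n, f x = f' x) (hF : ∀ x ∈ redFilt 𝒲 n, F x = F' x)
    {x : Reduced 𝒲} (hx : x ∈ redFilt 𝒲 (n + 1)) :
    nonlinearPart f F x = nonlinearPart f' F' x := by
  have hx' : eulerInv 𝒲 x ∈ redFilt 𝒲 (n + 1) :=
    map_mem_redFilt (fun n => (n : 𝕂)⁻¹) (fun _ _ _ => eulerInv_toReduced) hx
  refine redConv_congr (g := f ∘ₗ euler 𝒲) (g' := f' ∘ₗ euler 𝒲) (fun y hy => ?_) hF hx'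
  have hy' : euler 𝒲 y ∈ redFilt 𝒲 n :=
    map_mem_redFilt (fun n => (n : 𝕂)) (fun _ _ _ => euler_toReduced) hy
  rw [LinearMap.comp_apply, LinearMap.comp_apply, hf _ hy']

/-- A morphism of coalgebras can be recursively prescribed through its linear component. -/
theorem exists_isCoalgebraHom {j : W →ₗ[𝕂] W'} (hj : IsOfDegree 𝒲 𝒲' 0 j)
    {T : Reduced 𝒲' →ₗ[𝕂] W'} (hT : IsOfDegree (redDeg 𝒲') 𝒲' 0 T) (hT' : T ∘ₗ incl 𝒲' = 0) :
    ∃ F : Reduced 𝒲 →ₗ[𝕂] Reduced 𝒲', IsOfDegree (redDeg 𝒲) (redDeg 𝒲') 0 F ∧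
      IsCoalgebraHom F ∧ pr 𝒲' ∘ₗ F = j ∘ₗ pr 𝒲 + T ∘ₗ F := by
  let f : (Reduced 𝒲 →ₗ[𝕂] Reduced 𝒲') → (Reduced 𝒲 →ₗ[𝕂] W') := fun F =>
    j ∘ₗ pr 𝒲 + T ∘ₗ F
  have hf_apply : ∀ F x, f F x = j (pr 𝒲 x) + T (F x) := fun _ _ => rfl
  have hf : ∀ F, IsOfDegree (redDeg 𝒲) (redDeg 𝒲') 0 F → IsOfDegree (redDeg 𝒲) 𝒲' 0 (f F) :=
    fun F hF => (hj.comp isOfDegree_pr (zero_add _)).add (hT.comp hF (zero_add _))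
  -- The linear component is evaluated on the non-linear part rather than on `F`: at a fixed point
  -- nothing changes, as `T` ignores `⊙^1`, but now `Ψ F` on length at most `n + 1` depends only on
  -- `F` on length at most `n`.
  let Ψ : (Reduced 𝒲 →ₗ[𝕂] Reduced 𝒲') → (Reduced 𝒲 →ₗ[𝕂] Reduced 𝒲') := fun F =>
    incl 𝒲' ∘ₗ f (nonlinearPart (f F) F) + nonlinearPart (f F) F
  have hΨ_apply : ∀ F x, Ψ F x = incl 𝒲' (f (nonlinearPart (f F) F) x) +
    nonlinearPart (f F) F x := fun _ _ => rfl
  clear_value f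
  have hΨ : ∀ F, IsOfDegree (redDeg 𝒲) (redDeg 𝒲') 0 F →
      IsOfDegree (redDeg 𝒲) (redDeg 𝒲') 0 (Ψ F) := fun F hF =>
    have h := isOfDegree_nonlinearPart (hf F hF) hF
    (isOfDegree_incl.comp (hf _ h) (zero_add _)).add h
  clear_value Ψ
  have hcontr : ∀ (F G : Reduced 𝒲 →ₗ[𝕂] Reduced 𝒲') (n : ℕ), (∀ x ∈ redFilt 𝒲 n, F x = G x) →
      ∀ x ∈ redFilt 𝒲 (n + 1), Ψ F x = Ψ G x := by
    intro F G n h x hx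
    have hx' : nonlinearPart (f F) F x = nonlinearPart (f G) G x :=
      nonlinearPart_congr (fun y hy => by rw [hf_apply, hf_apply, h y hy]) h hx
    rw [hΨ_apply, hΨ_apply, hf_apply, hf_apply, hx']
  obtain ⟨F, hF, hFn⟩ := exists_fixedPoint (redFilt 𝒲) redFilt_mono redFilt_zero
    exists_mem_redFilt Ψ hcontr
  -- Homogeneity is preserved by `Ψ`, and the fixed point agrees at each element with some iterate
  -- of `Ψ` on `0`.
  have hdeg : IsOfDegree (redDeg 𝒲) (redDeg 𝒲') 0 F := by
    have h : ∀ n, IsOfDegree (redDeg 𝒲) (redDeg 𝒲') 0 (Ψ^[n] 0) := by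
      intro n
      induction n with
      | zero => exact IsOfDegree.zero 0
      | succ n ih => rw [Function.iterate_succ_apply']; exact hΨ _ ih
    intro k x hx
    obtain ⟨n, hn⟩ := hFn x
    rw [hn]
    exact h n k x hx
  -- Applying `T` to the fixed point equation shows that `T F` equals `T` of the non-linear part, so
  -- the linear component is the intended `f F`.
  have hF' : ∀ x, F x = incl 𝒲' (f F x) + nonlinearPart (f F) F x := by
    intro x
    have h := hΨ_apply F x
    have hT'' : ∀ v, T (incl 𝒲' v) = 0 := LinearMap.congr_fun hT'
    have hTF := congrArg T h
    rw [hF, map_add, hT'', zero_add] at hTF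
    rw [hF, hf_apply, ← hTF, ← hf_apply] at h
    exact h
  refine ⟨F, hdeg, isCoalgebraHom_of_comul_comp_unital
    (comul_comp_unital (f := f F) hdeg (hf F hdeg) ?_), ?_⟩
  · ext1 x
    rw [LinearMap.comp_apply, hF', nonlinearPart_euler]
    rfl
  · ext1 x
    rw [LinearMap.comp_apply, hF', map_add, pr_incl, pr_nonlinearPart, add_zero, hf_apply]
    rfl

end Lifting

end GSym

/-! ### Uniqueness and commutation principles, and the identities contained in `Q Q = 0`. -/

section Coderivation

variable {R : Type*} [CommRing R] {M N : Type*} [AddCommGroup M] [Module R M] [AddCommGroup N]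
  [Module R N] {d : M →ₗ[R] M ⊗[R] M} {c : N →ₗ[R] N ⊗[R] N}

theorem comp_sub_of_comp_eq_map {F G : M →ₗ[R] N} (hF : c ∘ₗ F = TensorProduct.map F F ∘ₗ d)
    (hG : c ∘ₗ G = TensorProduct.map G G ∘ₗ d) :
    c ∘ₗ (F - G) = (TensorProduct.map (F - G) F + TensorProduct.map G (F - G)) ∘ₗ d := by
  rw [LinearMap.comp_sub, hF, hG, ← LinearMap.sub_comp, tensorMap_sub_tensorMap]

theorem comp_sub_of_comp_eq_map_add {a b A B : M →ₗ[R] N}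
    (ha : c ∘ₗ a = (TensorProduct.map a A + TensorProduct.map B a) ∘ₗ d)
    (hb : c ∘ₗ b = (TensorProduct.map b A + TensorProduct.map B b) ∘ₗ d) :
    c ∘ₗ (a - b) = (TensorProduct.map (a - b) A + TensorProduct.map B (a - b)) ∘ₗ d := by
  rw [LinearMap.comp_sub, ha, hb, ← LinearMap.sub_comp, add_sub_add_comm, tensorMap_sub_left,
    tensorMap_sub_right]

/-- The two cross terms of the square differ by the sign in `hs` and cancel, so the square is an
ordinary coderivation. -/
theorem comp_sq_of_comp_eq_map_add {D s : M →ₗ[R] M}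
    (hD : d ∘ₗ D = (TensorProduct.map D LinearMap.id + TensorProduct.map s D) ∘ₗ d)
    (hs : s ∘ₗ D = (-1 : R) • (D ∘ₗ s)) (hss : s ∘ₗ s = LinearMap.id) :
    d ∘ₗ (D ∘ₗ D) = (TensorProduct.map (D ∘ₗ D) LinearMap.id +
      TensorProduct.map LinearMap.id (D ∘ₗ D)) ∘ₗ d := by
  rw [← LinearMap.comp_assoc, hD, LinearMap.comp_assoc, hD]
  ext1 x
  simp only [LinearMap.comp_apply, LinearMap.add_apply, map_add, TensorProduct.map_map,
    LinearMap.id_comp, LinearMap.comp_id, hs, hss, TensorProduct.map_smul_left,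
    LinearMap.smul_apply]
  rw [neg_one_smul]
  abel

end Coderivation

open GSym

open TensorProduct (map)

namespace LInftyAlgebra

variable {𝕂 : Type*} [Field 𝕂] {V : Type*} [AddCommGroup V] [Module 𝕂 V]
  {𝒱 : ℤ → Submodule 𝕂 V} [DirectSum.Decomposition 𝒱] (L : LInftyAlgebra 𝒱)

theorem qPlus_comp_incl : L.qPlus ∘ₗ incl (shift 𝒱 1) = 0 := by
  ext w
  simp [qPlus, pr_incl]

theorem q_eq : L.q = L.q₁ ∘ₗ pr (shift 𝒱 1) + L.qPlus := by
  ext x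
  simp [qPlus, q₁]

theorem isOfDegree_qPlus : IsOfDegree (redDeg (shift 𝒱 1)) (shift 𝒱 1) 1 L.qPlus :=
  L.isOfDegree_q.comp (IsOfDegree.id.sub (isOfDegree_incl.comp isOfDegree_pr (zero_add _)))
    (zero_add _)

theorem q_comp_Q : L.q ∘ₗ L.Q = 0 := by
  rw [← pr_comp_coderivation L.q, LinearMap.comp_assoc, Q, L.coderivation_sq, LinearMap.comp_zero]

theorem q₁_comp_q₁ : L.q₁ ∘ₗ L.q₁ = 0 := by
  have h : L.Q ∘ₗ incl (shift 𝒱 1) = incl (shift 𝒱 1) ∘ₗ L.q₁ := by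
    ext1 w
    rw [Q, coderivation_eq, LinearMap.comp_apply, LinearMap.add_apply, redConv]
    simp only [LinearMap.comp_apply, redComul_incl, map_zero, add_zero, q₁]
  calc L.q₁ ∘ₗ L.q₁ = L.q ∘ₗ incl (shift 𝒱 1) ∘ₗ L.q₁ := rfl
    _ = (L.q ∘ₗ L.Q) ∘ₗ incl (shift 𝒱 1) := by rw [← h]; rfl
    _ = 0 := by rw [q_comp_Q, LinearMap.zero_comp]

/-- The linear component of `Q Q = 0`, from which the term `q₁ q₁ pr = 0` has been removed. -/
theorem q₁_qPlus (x : Reduced (shift 𝒱 1)) : L.q₁ (L.qPlus x) + L.qPlus (L.Q x) = 0 := by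
  have h := LinearMap.congr_fun L.q_comp_Q x
  have h1 : pr (shift 𝒱 1) (L.Q x) = L.q x := LinearMap.congr_fun (pr_comp_coderivation L.q) x
  have h2 := LinearMap.congr_fun L.q₁_comp_q₁ (pr (shift 𝒱 1) x)
  rw [LinearMap.comp_apply] at h h2
  rw [q_eq, LinearMap.add_apply, LinearMap.comp_apply, h1, q_eq, LinearMap.add_apply,
    LinearMap.comp_apply, map_add, h2, LinearMap.zero_apply, zero_add] at h
  exact h

end LInftyAlgebra

namespace GSym

variable {𝕂 : Type*} [Field 𝕂] [CharZero 𝕂] {W : Type*} [AddCommGroup W] [Module 𝕂 W]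
  {W' : Type*} [AddCommGroup W'] [Module 𝕂 W']
  {𝒲 : ℤ → Submodule 𝕂 W} [DirectSum.Decomposition 𝒲]
  {𝒲' : ℤ → Submodule 𝕂 W'} [DirectSum.Decomposition 𝒲']

theorem IsCoalgebraHom.eq_of_pr_comp {F G : Reduced 𝒲 →ₗ[𝕂] Reduced 𝒲'} (hF : IsCoalgebraHom F)
    (hG : IsCoalgebraHom G) {f : Reduced 𝒲 →ₗ[𝕂] W'} {T : Reduced 𝒲' →ₗ[𝕂] W'}
    (hT : T ∘ₗ incl 𝒲' = 0) (hF' : pr 𝒲' ∘ₗ F = f + T ∘ₗ F) (hG' : pr 𝒲' ∘ₗ G = f + T ∘ₗ G) :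
    F = G := by
  rw [← sub_eq_zero]
  refine eq_zero_of_redComul (A := F) (B := G) (T := T) ?_ ?_ hT
  · exact comp_sub_of_comp_eq_map hF hG
  · rw [LinearMap.comp_sub, LinearMap.comp_sub, hF', hG', add_sub_add_left_eq_sub]

/-- Coalgebra morphisms preserve primitive elements. -/
theorem IsCoalgebraHom.exists_incl_eq {F : Reduced 𝒲 →ₗ[𝕂] Reduced 𝒲'} (hF : IsCoalgebraHom F)
    (w : W) : ∃ w', F (incl 𝒲 w) = incl 𝒲' w' := by
  refine ⟨_, eq_incl_of_redComul_eq_zero ?_⟩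
  refine (LinearMap.congr_fun hF _).trans ?_
  rw [LinearMap.comp_apply, redComul_incl, map_zero]

/-- The failure of a coalgebra morphism to commute
with coderivations vanishes if its linear component depends only on its non-linear components. -/
theorem IsCoalgebraHom.comp_coderivation {F : Reduced 𝒲 →ₗ[𝕂] Reduced 𝒲'} (hF : IsCoalgebraHom F)
    (hF0 : IsOfDegree (redDeg 𝒲) (redDeg 𝒲') 0 F) {k : ℤ} {p : Reduced 𝒲 →ₗ[𝕂] W}
    (hp : IsOfDegree (redDeg 𝒲) 𝒲 k p) {q : Reduced 𝒲' →ₗ[𝕂] W'}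
    (hq : IsOfDegree (redDeg 𝒲') 𝒲' k q) {T : Reduced 𝒲' →ₗ[𝕂] W'} (hT : T ∘ₗ incl 𝒲' = 0)
    (h : pr 𝒲' ∘ₗ (F ∘ₗ coderivation p - coderivation q ∘ₗ F) =
      T ∘ₗ (F ∘ₗ coderivation p - coderivation q ∘ₗ F)) :
    F ∘ₗ coderivation p = coderivation q ∘ₗ F := by
  rw [← sub_eq_zero]
  refine eq_zero_of_redComul (A := F) (B := F ∘ₗ redTwist 𝒲 k) ?_ h hT
  have htw : redTwist 𝒲' k ∘ₗ F = F ∘ₗ redTwist 𝒲 k := by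
    rw [IsOfDegree.redTwist_comp hF0, mul_zero, zpow_zero, one_smul]
  have h1 : redComul 𝒲' ∘ₗ F ∘ₗ coderivation p =
      (map (F ∘ₗ coderivation p) F + map (F ∘ₗ redTwist 𝒲 k) (F ∘ₗ coderivation p)) ∘ₗ
        redComul 𝒲 := by
    rw [← LinearMap.comp_assoc, hF, LinearMap.comp_assoc, redComul_comp_coderivation hp]
    ext1 x
    simp only [LinearMap.comp_apply, LinearMap.add_apply, map_add, TensorProduct.map_map,
      LinearMap.comp_id]
  have h2 : redComul 𝒲' ∘ₗ coderivation q ∘ₗ F =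
      (map (coderivation q ∘ₗ F) F + map (F ∘ₗ redTwist 𝒲 k) (coderivation q ∘ₗ F)) ∘ₗ
        redComul 𝒲 := by
    rw [← LinearMap.comp_assoc, redComul_comp_coderivation hq, LinearMap.comp_assoc, hF]
    ext1 x
    simp only [LinearMap.comp_apply, LinearMap.add_apply, TensorProduct.map_map,
      LinearMap.id_comp, htw]
  exact comp_sub_of_comp_eq_map_add h1 h2

/-- A coderivation of odd degree squares to zero if the linear component of its square does. -/
theorem coderivation_sq_eq_zero {k : ℤ} (hk : Odd k) {q : Reduced 𝒲 →ₗ[𝕂] W}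
    (hq : IsOfDegree (redDeg 𝒲) 𝒲 k q) (h : q ∘ₗ coderivation q = 0) :
    coderivation q ∘ₗ coderivation q = 0 := by
  refine eq_zero_of_redComul (A := LinearMap.id) (B := LinearMap.id) (T := 0) ?_ ?_
    (LinearMap.zero_comp _)
  · refine comp_sq_of_comp_eq_map_add (redComul_comp_coderivation hq) ?_
      (redTwist_comp_redTwist_of_even k ⟨k, rfl⟩)
    rw [IsOfDegree.redTwist_comp (isOfDegree_coderivation hq), (hk.mul hk).neg_one_zpow]
  · rw [← LinearMap.comp_assoc, pr_comp_coderivation, h, LinearMap.zero_comp]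

end GSym

end LInf
end

/-! ### The transfer theorem. -/

theorem mainTheorem4 {𝕂 : Type*} [Field 𝕂] [CharZero 𝕂]
    {V : Type*} [AddCommGroup V] [Module 𝕂 V]
    {C : Type*} [AddCommGroup C] [Module 𝕂 C]
    (𝒱 : ℤ → Submodule 𝕂 V) [DirectSum.Decomposition 𝒱]
    (𝒞 : ℤ → Submodule 𝕂 C) [DirectSum.Decomposition 𝒞]
    (L : LInf.LInftyAlgebra 𝒱)
    (δ : C →ₗ[𝕂] C) (hδ : LInf.IsOfDegree 𝒞 𝒞 1 δ) (hδδ : δ ∘ₗ δ = 0)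
    (i : C →ₗ[𝕂] V) (hi : LInf.IsOfDegree (LInf.shift 𝒞 1) (LInf.shift 𝒱 1) 0 i)
    (hiδ : i ∘ₗ LInf.suspend δ = L.q₁ ∘ₗ i)
    (π : V →ₗ[𝕂] C) (hπ : LInf.IsOfDegree (LInf.shift 𝒱 1) (LInf.shift 𝒞 1) 0 π)
    (hπδ : π ∘ₗ L.q₁ = LInf.suspend δ ∘ₗ π)
    (K : V →ₗ[𝕂] V) (hK : LInf.IsOfDegree (LInf.shift 𝒱 1) (LInf.shift 𝒱 1) (-1) K)
    (hKq : L.q₁ ∘ₗ K + K ∘ₗ L.q₁ = i ∘ₗ π - LinearMap.id) :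
    ∃ (A : LInf.LInftyAlgebra 𝒞) (Φ : LInf.LInftyHom A L),
      A.q₁ = LInf.suspend δ ∧
      Φ.f₁ = i ∧
      Φ.f = i ∘ₗ LInf.GSym.pr (LInf.shift 𝒞 1) + K ∘ₗ L.qPlus ∘ₗ Φ.F ∧
      A.q = LInf.suspend δ ∘ₗ LInf.GSym.pr (LInf.shift 𝒞 1) + π ∘ₗ L.qPlus ∘ₗ Φ.F ∧
      ∀ F : LInf.GSym.Reduced (LInf.shift 𝒞 1) →ₗ[𝕂] LInf.GSym.Reduced (LInf.shift 𝒱 1),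
        LInf.GSym.IsCoalgebraHom F →
        LInf.GSym.pr (LInf.shift 𝒱 1) ∘ₗ F =
          i ∘ₗ LInf.GSym.pr (LInf.shift 𝒞 1) + K ∘ₗ L.qPlus ∘ₗ F →
        F = Φ.F := by
  open LInf LInf.GSym in
  have hT : (K ∘ₗ L.qPlus) ∘ₗ incl (shift 𝒱 1) = 0 := by
    rw [LinearMap.comp_assoc, L.qPlus_comp_incl, LinearMap.comp_zero]
  have hT0 : IsOfDegree (redDeg (shift 𝒱 1)) (shift 𝒱 1) 0 (K ∘ₗ L.qPlus) :=
    hK.comp L.isOfDegree_qPlus (by norm_num)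
  obtain ⟨F, hF0, hF, hprF⟩ := exists_isCoalgebraHom hi hT0 hT
  have hδ₁ : IsOfDegree (shift 𝒞 1) (shift 𝒞 1) 1 (suspend δ) := fun k c hc =>
    neg_mem (hδ (k + 1) c hc)
  set q := suspend δ ∘ₗ pr (shift 𝒞 1) + π ∘ₗ L.qPlus ∘ₗ F with hq_def
  have hq : IsOfDegree (redDeg (shift 𝒞 1)) (shift 𝒞 1) 1 q :=
    (hδ₁.comp isOfDegree_pr (zero_add _)).add
      (hπ.comp (L.isOfDegree_qPlus.comp hF0 (zero_add _)) (add_zero _))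
  have hprF' : ∀ x, pr (shift 𝒱 1) (F x) = i (pr (shift 𝒞 1) x) + K (L.qPlus (F x)) :=
    LinearMap.congr_fun hprF
  have hprq : ∀ x, pr (shift 𝒞 1) (coderivation q x) = q x :=
    LinearMap.congr_fun (pr_comp_coderivation q)
  have hprQ : ∀ x, pr (shift 𝒱 1) (coderivation L.q x) = L.q x :=
    LinearMap.congr_fun (pr_comp_coderivation L.q)
  have hq' : ∀ x, q x = suspend δ (pr (shift 𝒞 1) x) + π (L.qPlus (F x)) := fun _ => rfl
  have hLq : ∀ x, L.q x = L.q₁ (pr (shift 𝒱 1) x) + L.qPlus x := LinearMap.congr_fun L.q_eq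
  have hiδ' : ∀ c, i (suspend δ c) = L.q₁ (i c) := LinearMap.congr_fun hiδ
  have hπδ' : ∀ v, π (L.q₁ v) = suspend δ (π v) := LinearMap.congr_fun hπδ
  have hKq' : ∀ v, L.q₁ (K v) + K (L.q₁ v) = i (π v) - v := LinearMap.congr_fun hKq
  -- Commutation is proved before `q ∘ₗ coderivation q = 0`, which depends on it. In the linear
  -- component, `i π - id - q₁ K` is replaced by `K q₁`, and `K q₁ q₊ = -K q₊ Q` turns the result
  -- into `K q₊` of the same defect.
  have hcomm : F ∘ₗ coderivation q = coderivation L.q ∘ₗ F := by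
    refine hF.comp_coderivation hF0 hq L.isOfDegree_q hT ?_
    ext1 x
    have h1 : K (L.q₁ (L.qPlus (F x))) + K (L.qPlus (coderivation L.q (F x))) = 0 := by
      rw [← map_add, ← map_zero K]
      exact congrArg K (L.q₁_qPlus (F x))
    have h2 := hKq' (L.qPlus (F x))
    simp only [LinearMap.comp_apply, LinearMap.sub_apply, map_sub, hprF', hprq, hprQ, hq', hLq,
      map_add, hiδ']
    rw [eq_add_of_sub_eq h2.symm, eq_neg_of_add_eq_zero_left h1]
    abel
  have hqQ : q ∘ₗ coderivation q = 0 := by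
    ext1 x
    have h1 := congrArg π (L.q₁_qPlus (F x))
    rw [map_add, map_zero, hπδ'] at h1
    have h2 : F (coderivation q x) = L.Q (F x) := LinearMap.congr_fun hcomm x
    have h3 : ∀ c, suspend δ (suspend δ c) = 0 := fun c => by
      have := LinearMap.congr_fun hδδ c
      simpa [suspend] using this
    rw [LinearMap.comp_apply, hq', hprq, hq', map_add, h3, zero_add, h2, h1]
    rfl
  -- `F` maps `⊙^1` into `⊙^1`, so the corrections by `q₊` do not affect the linear parts of `F` and
  -- `q`.
  have hFincl : ∀ c, L.qPlus (F (incl (shift 𝒞 1) c)) = 0 := fun c => by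
    obtain ⟨v, hv⟩ := hF.exists_incl_eq c
    rw [hv]
    exact LinearMap.congr_fun L.qPlus_comp_incl v
  refine ⟨⟨q, hq, coderivation_sq_eq_zero odd_one hq hqQ⟩,
    ⟨pr (shift 𝒱 1) ∘ₗ F, isOfDegree_pr.comp hF0 (zero_add _), F, hF, rfl, hcomm⟩, ?_, ?_, hprF,
    rfl, fun G hG hprG => hG.eq_of_pr_comp hF hT hprG hprF⟩
  · ext1 c
    change q (incl (shift 𝒞 1) c) = _
    rw [hq', pr_incl, hFincl, map_zero, add_zero]
  · ext1 c
    change pr (shift 𝒱 1) (F (incl (shift 𝒞 1) c)) = _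
    rw [hprF', pr_incl, hFincl, map_zero, add_zero]
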